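/- **Setting.** A network is a connected, locally finite multigraph $G$ in which every vertex, and every pair $(v,e)$ of an edge $e$ and an endpoint $v$ of $e$, carries a mark in a complete separable metric space $\Xi$. Let $\mathcal G$, $\mathcal G_*$, $\mathcal G_{**}$ be the sets of isomorphism classes $[G]$, $[G,o]$, $[G,o,v]$ of networks, rooted networks and doubly-rooted networks. The last two carry the Borel sigma-field of local convergence; $\mathcal G$ carries the sigma-field $J$ of all sets whose preimage under $\pi:[G,o]\mapsto[G]$ is measurable. Let $I$ be the sigma-field of measurable $A\subseteq\mathcal G_*$ such that $[G,o]\in A$ implies $[G,v]\in A$ for all $v\in V(G)$. For measurable $g:\mathcal G_{**}\to\mathbb R^{\ge 0}$ write $g_G(u,v)=g[G,u,v]$, $g_G^+(o)=\sum_{v\in V(G)} g_G(o,v)$ and $g_G^-(o)=\sum_{v\in V(G)} g_G(v,o)$. A random rooted network $[\mathbf G,\mathbf o]$ is unimodular if $\mathbb E[g_{\mathbf G}^+(\mathbf o)]=\mathbb E[g_{\mathbf G}^-(\mathbf o)]$ for all such $g$. A covariant subset $S$ assigns to each network $G$ a set $S_G\subseteq V(G)$, compatibly with isomorphisms, such that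 $\{[G,o]: o\in S_G\}$ is measurable; $S_G$ also denotes the induced subnetwork. Let $[\mathbf G_0,\mathbf o_0]$ be a unimodular network, and let $([\mathbf G,\mathbf o],S)$ be a proper extension of it: $[\mathbf G,\mathbf o]$ is a random rooted network (whose mark space may be larger than that of $\mathbf G_0$) and $S$ is a covariant subset such that almost surely $\mathbf o\in S_{\mathbf G}$ and $S_{\mathbf G}$ is connected, $[S_{\mathbf G},\mathbf o]$ has the same distribution as $[\mathbf G_0,\mathbf o_0]$, and $$\mathbb E\Big[\sum_{v\in S_{\mathbf G}} g[\mathbf G,\mathbf o,v]\Big]=\mathbb E\Big[\sum_{v\in S_{\mathbf G}} g[\mathbf G,v,\mathbf o]\Big]\quad\text{for all measurable } g:\mathcal G_{**}\to\mathbb R^{\ge 0}.$$ A unimodularization of $[\mathbf G]$ is a unimodular random rooted network $[\mathbf G',\mathbf o']$ such that the distributions of $[\mathbf G']$ and $[\mathbf G]$ on $(\mathcal G,J)$ are mutually absolutely continuous. Call a measurable $T:\mathcal G_{**}\to\mathbb R^{\ge 0}$ *admissible* if almost surely, for all $v\in V(\mathbf G)$, $T_{\mathbf G}^+(v)=1$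 and $T_{\mathbf G}(v,z)=0$ for all $z\in V(\mathbf G)\setminus S_{\mathbf G}$. Put $M:=T_{\mathbf G}^-(\mathbf o)$. We say that $\mathcal P'_T$ exists if $0<\mathbb E[M\mid I]<\infty$ almost surely and $$\mathcal P'_T[A]:=\mathbb E\Big[\frac{1}{\mathbb E[M\mid I]}\sum_{v\in V(\mathbf G)}T_{\mathbf G}(v,\mathbf o)\,\mathbf 1_A[\mathbf G,v]\Big]$$ is a probability measure on $\mathcal G_*$. **Theorem (Existence of $T$).** If $[\mathbf G]$ can be unimodularized (i.e. has a unimodularization), then: (i) There exists an admissible $T$ such that $\mathcal P'_T$ exists. (ii) For every $T$ as in (i), every unimodularization $\nu$ of $[\mathbf G]$ is obtained by biasing $\mathcal P'_T$ by a function that does not depend on the root: there is a measurable $w:\mathcal G_*\to\mathbb R^{\ge 0}$ with $w[G,o]=w[G,v]$ for all networks $G$ and $o,v\in V(G)$, $0<\int w\,d\mathcal P'_T<\infty$, and $\nu[A]=\int_A w\,d\mathcal P'_T\big/\int w\,d\mathcal P'_T$ for all measurable $A\subseteq\mathcal G_*$. (iii) $T$ in (i) can be chosen such that almost surely $T_{\mathbf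 G}^-(\cdot)$ is constant on $S_{\mathbf G}$ and depends only on $[\mathbf G]$: there is a $J$-measurable $c:\mathcal G\to\mathbb R^{\ge 0}$ such that almost surely $T_{\mathbf G}^-(v)=c[\mathbf G]$ for all $v\in S_{\mathbf G}$. -/

import Mathlib

open MeasureTheory
open scoped NNReal ENNReal

/-- A locally finite multigraph (loops and multiple edges allowed) with marks in `Ξ`: every vertex
`v` and every pair `(v, e)` of an edge `e` and an endpoint `v` of `e` carries a mark.
It need not be connected. -/
structure MarkedGraph (Ξ : Type*) where
  V : Type
  E : Type
  ends : E → Sym2 V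
  vmark : V → Ξ
  emark : ∀ (v : V) (e : E), v ∈ ends e → Ξ
  locallyFinite : ∀ v, {e | v ∈ ends e}.Finite

namespace MarkedGraph

variable {Ξ : Type*}

/-- The adjacency relation of the multigraph. -/
def graph (G : MarkedGraph Ξ) : SimpleGraph G.V :=
  SimpleGraph.fromRel fun u v => ∃ e, G.ends e = s(u, v)

/-- The subnetwork induced by a set of vertices: all edges with both endpoints in the set. -/
def induce (G : MarkedGraph Ξ) (s : Set G.V) : MarkedGraph Ξ where
  V := s
  E := {e : G.E // ∀ v ∈ G.ends e, v ∈ s}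
  ends e := (G.ends e.1).attachWith e.2
  vmark v := G.vmark v.1
  emark v e h := G.emark v.1 e.1 (by
    rw [← Sym2.attachWith_map_subtypeVal e.2]
    exact Sym2.mem_map.2 ⟨v, h, rfl⟩)
  locallyFinite v := by
    refine ((G.locallyFinite v.1).preimage Subtype.val_injective.injOn).subset ?_
    intro e h
    change v.1 ∈ G.ends e.1
    rw [← Sym2.attachWith_map_subtypeVal e.2]
    exact Sym2.mem_map.2 ⟨v, h, rfl⟩

/-- The same graph with all marks pushed through a map between mark spaces. -/
def mapMarks {Ξ' : Type*} (ι : Ξ → Ξ') (G : MarkedGraph Ξ) : MarkedGraph Ξ' where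
  V := G.V
  E := G.E
  ends := G.ends
  vmark v := ι (G.vmark v)
  emark v e h := ι (G.emark v e h)
  locallyFinite := G.locallyFinite

/-- A graph isomorphism under which corresponding marks are related by `R`. For `R = Eq` this is an
isomorphism of networks; for `R x y := dist x y < ε` it is a graph isomorphism that preserves the
marks up to an error smaller than `ε`. -/
structure IsoUpTo (R : Ξ → Ξ → Prop) (G H : MarkedGraph Ξ) where
  toV : G.V ≃ H.V
  toE : G.E ≃ H.E
  map_ends : ∀ e, H.ends (toE e) = (G.ends e).map toV
  vmark_rel : ∀ v, R (G.vmark v) (H.vmark (toV v))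
  emark_rel : ∀ v e (h : v ∈ G.ends e) (h' : toV v ∈ H.ends (toE e)),
    R (G.emark v e h) (H.emark (toV v) (toE e) h')

/-- Isomorphism of networks (preserving marks). -/
abbrev Iso (G H : MarkedGraph Ξ) := IsoUpTo (· = ·) G H

/-- The identity isomorphism. -/
def Iso.refl (G : MarkedGraph Ξ) : Iso G G where
  toV := Equiv.refl _
  toE := Equiv.refl _
  map_ends e := by simp
  vmark_rel _ := rfl
  emark_rel _ _ _ _ := rfl

/-- The inverse isomorphism. -/
def Iso.symm {G H : MarkedGraph Ξ} (φ : Iso G H) : Iso H G where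
  toV := φ.toV.symm
  toE := φ.toE.symm
  map_ends e := by
    have h := φ.map_ends (φ.toE.symm e)
    rw [Equiv.apply_symm_apply] at h
    rw [h, Sym2.map_map]
    simp
  vmark_rel v := by
    have h := φ.vmark_rel (φ.toV.symm v)
    rw [Equiv.apply_symm_apply] at h
    exact h.symm
  emark_rel v e h h' := by
    obtain ⟨v, rfl⟩ := φ.toV.surjective v
    obtain ⟨e, rfl⟩ := φ.toE.surjective e
    have key : ∀ w f (hw : w ∈ G.ends f), w = v → f = e →
        H.emark (φ.toV v) (φ.toE e) h = G.emark w f hw := by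
      rintro w f hw rfl rfl
      exact (φ.emark_rel w f hw h).symm
    exact key _ _ h' (by simp) (by simp)

/-- Composition of isomorphisms. -/
def Iso.trans {G H K : MarkedGraph Ξ} (φ : Iso G H) (ψ : Iso H K) : Iso G K where
  toV := φ.toV.trans ψ.toV
  toE := φ.toE.trans ψ.toE
  map_ends e := by
    simp [ψ.map_ends, φ.map_ends, Sym2.map_map]
  vmark_rel v := (φ.vmark_rel v).trans (ψ.vmark_rel _)
  emark_rel v e h h' := by
    have h'' : φ.toV v ∈ H.ends (φ.toE e) := by
      rw [φ.map_ends]; exact Sym2.mem_map.2 ⟨v, h, rfl⟩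
    exact (φ.emark_rel v e h h'').trans (ψ.emark_rel _ _ h'' h')

end MarkedGraph

/-- A network: a connected (in particular nonempty), locally finite marked multigraph.
Its vertex set is automatically countable. -/
structure Network (Ξ : Type*) extends MarkedGraph Ξ where
  connected : toMarkedGraph.graph.Connected

/-- A network with an `n`-tuple of distinguished vertices. -/
structure RootedNetwork (Ξ : Type*) (n : ℕ) where
  net : Network Ξ
  root : Fin n → net.V

namespace RootedNetwork

variable {Ξ : Type*} {n : ℕ}

/-- Isomorphism of networks that takes the roots of one to those of the other. -/
instance setoid (Ξ : Type*) (n : ℕ) : Setoid (RootedNetwork Ξ n) where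
  r x y := ∃ φ : MarkedGraph.Iso x.net.toMarkedGraph y.net.toMarkedGraph,
    ∀ i, φ.toV (x.root i) = y.root i
  iseqv :=
    { refl := fun x => ⟨MarkedGraph.Iso.refl _, fun _ => rfl⟩
      symm := by
        rintro x y ⟨φ, hφ⟩
        exact ⟨φ.symm, fun i => by simp [MarkedGraph.Iso.symm, ← hφ]⟩
      trans := by
        rintro x y z ⟨φ, hφ⟩ ⟨ψ, hψ⟩
        exact ⟨φ.trans ψ, fun i => by simp [MarkedGraph.Iso.trans, hφ, hψ]⟩ }

/-- The vertices at graph distance at most `k` from one of the roots. -/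
def ball (x : RootedNetwork Ξ n) (k : ℕ) : Set x.net.V :=
  {v | ∃ i, x.net.graph.dist (x.root i) v ≤ k}

/-- The balls of radius `k` around the roots are isomorphic as graphs, by an isomorphism that takes
roots to roots and under which corresponding marks are at distance less than `ε`. -/
def IsClose [MetricSpace Ξ] (k : ℕ) (ε : ℝ) (x y : RootedNetwork Ξ n) : Prop :=
  ∃ φ : MarkedGraph.IsoUpTo (fun a b => dist a b < ε)
      (x.net.induce (x.ball k)) (y.net.induce (y.ball k)),
    ∀ i (h : x.root i ∈ x.ball k), (φ.toV ⟨x.root i, h⟩).1 = y.root i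

end RootedNetwork

/-- Isomorphism classes of networks with `n` roots. For `n = 0, 1, 2` these are the spaces
`𝒢`, `𝒢_*` and `𝒢_**` of non-rooted, rooted and doubly-rooted networks. -/
def NetClass (Ξ : Type*) (n : ℕ) := Quotient (RootedNetwork.setoid Ξ n)

namespace Network

variable {Ξ : Type*}

/-- The class `[G]`. -/
def cls₀ (G : Network Ξ) : NetClass Ξ 0 := Quotient.mk _ ⟨G, ![]⟩

/-- The class `[G, o]`. -/
def cls₁ (G : Network Ξ) (o : G.V) : NetClass Ξ 1 := Quotient.mk _ ⟨G, ![o]⟩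

/-- The class `[G, o, v]`. -/
def cls₂ (G : Network Ξ) (o v : G.V) : NetClass Ξ 2 := Quotient.mk _ ⟨G, ![o, v]⟩

/-- The same network with all marks pushed through a map between mark spaces. -/
def mapMarks {Ξ' : Type*} (ι : Ξ → Ξ') (G : Network Ξ) : Network Ξ' where
  toMarkedGraph := G.toMarkedGraph.mapMarks ι
  connected := G.connected

end Network

namespace NetClass

variable {Ξ : Type*}

/-- The topology of local convergence on `𝒢_*` and `𝒢_**`, generated by the sets of (classes of)
networks that are `k`, `ε`-close to a given one. -/
instance [MetricSpace Ξ] {n : ℕ} [NeZero n] : TopologicalSpace (NetClass Ξ n) :=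
  TopologicalSpace.generateFrom
    {U | ∃ (x : RootedNetwork Ξ n) (k : ℕ) (ε : ℝ), 0 < ε ∧
      U = {q | ∃ y : RootedNetwork Ξ n, Quotient.mk _ y = q ∧ x.IsClose k ε y}}

/-- The Borel sigma-field on `𝒢_*` and `𝒢_**`. -/
instance [MetricSpace Ξ] {n : ℕ} [NeZero n] : MeasurableSpace (NetClass Ξ n) := borel _

instance [MetricSpace Ξ] {n : ℕ} [NeZero n] : BorelSpace (NetClass Ξ n) := ⟨rfl⟩

/-- The underlying network `G` of a chosen representative `(G, o)` of a class in `𝒢_*`. -/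
noncomputable def G (x : NetClass Ξ 1) : Network Ξ := (Quotient.out x).net

/-- The root `o` of a chosen representative `(G, o)` of a class in `𝒢_*`. -/
noncomputable def o (x : NetClass Ξ 1) : x.G.V := (Quotient.out x).root 0

theorem cls₁_G_o (x : NetClass Ξ 1) : x.G.cls₁ x.o = x := by
  conv_rhs => rw [← Quotient.out_eq x]
  unfold Network.cls₁
  congr 1
  unfold NetClass.G NetClass.o
  generalize Quotient.out x = y
  obtain ⟨net, root⟩ := y
  congr 1
  funext i
  fin_cases i
  rfl

/-- The projection `𝒢_* → 𝒢` that forgets the root. -/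
noncomputable def π (x : NetClass Ξ 1) : NetClass Ξ 0 := x.G.cls₀

/-- The sigma-field `J` on `𝒢`: the sets whose preimage under `π` is measurable. -/
noncomputable instance [MetricSpace Ξ] : MeasurableSpace (NetClass Ξ 0) :=
  MeasurableSpace.map π inferInstance

/-- The invariant sigma-field `I` on `𝒢_*`: the measurable sets that do not depend on the root. -/
@[reducible] def invariant (Ξ : Type*) [MetricSpace Ξ] : MeasurableSpace (NetClass Ξ 1) where
  MeasurableSet' A := MeasurableSet A ∧
    ∀ (G : Network Ξ) (o v : G.V), G.cls₁ o ∈ A → G.cls₁ v ∈ A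
  measurableSet_empty := ⟨MeasurableSet.empty, by simp⟩
  measurableSet_compl A hA :=
    ⟨hA.1.compl, fun G o v ho hv => ho (hA.2 G v o hv)⟩
  measurableSet_iUnion f hf := by
    refine ⟨MeasurableSet.iUnion fun i => (hf i).1, fun G o v ho => ?_⟩
    obtain ⟨i, hi⟩ := Set.mem_iUnion.1 ho
    exact Set.mem_iUnion.2 ⟨i, (hf i).2 G o v hi⟩

end NetClass

/-- The mass `g⁺_G(o)` that leaves `o`. -/
noncomputable def outflow {Ξ : Type*} (g : NetClass Ξ 2 → ℝ≥0) (G : Network Ξ) (o : G.V) : ℝ≥0∞ :=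
  ∑' v : G.V, (g (G.cls₂ o v) : ℝ≥0∞)

/-- The mass `g⁻_G(o)` that enters `o`. -/
noncomputable def inflow {Ξ : Type*} (g : NetClass Ξ 2 → ℝ≥0) (G : Network Ξ) (o : G.V) : ℝ≥0∞ :=
  ∑' v : G.V, (g (G.cls₂ v o) : ℝ≥0∞)

/-- A covariant subset of the vertices. -/
structure CovariantSubset (Ξ : Type*) [MetricSpace Ξ] where
  carrier : ∀ G : Network Ξ, Set G.V
  covariant : ∀ (G H : Network Ξ) (φ : MarkedGraph.Iso G.toMarkedGraph H.toMarkedGraph),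
    φ.toV '' carrier G = carrier H
  measurable : MeasurableSet {x : NetClass Ξ 1 | x.o ∈ carrier x.G}

section

variable {Ξ : Type*} [MetricSpace Ξ]

/-- Unimodularity (mass transport principle). -/
def IsUnimodular (μ : Measure (NetClass Ξ 1)) : Prop :=
  ∀ g : NetClass Ξ 2 → ℝ≥0, Measurable g →
    ∫⁻ x, outflow g x.G x.o ∂μ = ∫⁻ x, inflow g x.G x.o ∂μ

/-- `ν` is a (weak) unimodularization of the non-rooted network `[G]`, where `[G, o]` has
distribution `μ`: it is a unimodular probability measure, and the distributions of the underlying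
non-rooted networks on `(𝒢, J)` are mutually absolutely continuous. -/
structure IsUnimodularization (ν μ : Measure (NetClass Ξ 1)) : Prop where
  isProbabilityMeasure : IsProbabilityMeasure ν
  isUnimodular : IsUnimodular ν
  absolutelyContinuous : ν.map NetClass.π ≪ μ.map NetClass.π
  absolutelyContinuous' : μ.map NetClass.π ≪ ν.map NetClass.π

/-- `([G, o], S)`, with `[G, o]` of distribution `μ`, is a proper extension of the unimodular network
`[G₀, o₀]` of distribution `μ₀`. The mark space of the former contains that of the latter
by means of `ι`. -/
structure IsProperExtension {Ξ₀ : Type*} [MetricSpace Ξ₀] (ι : Ξ₀ → Ξ)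
    (μ₀ : Measure (NetClass Ξ₀ 1)) (μ : Measure (NetClass Ξ 1)) (S : CovariantSubset Ξ) : Prop where
  isUnimodular : IsUnimodular μ₀
  root_mem : ∀ᵐ x ∂μ, x.o ∈ S.carrier x.G
  connected : ∀ᵐ x ∂μ, (x.G.induce (S.carrier x.G)).graph.Connected
  /-- `[S_G, o]` has the same distribution as `[G₀, o₀]`. -/
  law_eq : ∀ A : Set (NetClass Ξ 1), MeasurableSet A →
    μ {x : NetClass Ξ 1 | ∃ (ho : x.o ∈ S.carrier x.G) (hc : (x.G.induce (S.carrier x.G)).graph.Connected),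
        Network.cls₁ ⟨x.G.induce (S.carrier x.G), hc⟩ ⟨x.o, ho⟩ ∈ A} =
      μ₀ {y : NetClass Ξ₀ 1 | (y.G.mapMarks ι).cls₁ y.o ∈ A}
  /-- The mass transport principle on `S`. -/
  mtp : ∀ g : NetClass Ξ 2 → ℝ≥0, Measurable g →
    ∫⁻ x, ∑' v : S.carrier x.G, (g (x.G.cls₂ x.o v) : ℝ≥0∞) ∂μ =
      ∫⁻ x, ∑' v : S.carrier x.G, (g (x.G.cls₂ v x.o) : ℝ≥0∞) ∂μ

/-- `T` is measurable and `T_G` is almost surely a Markovian transport kernel from `V(G)` to `S_G`. -/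
structure IsMarkovianKernel (μ : Measure (NetClass Ξ 1)) (S : CovariantSubset Ξ)
    (T : NetClass Ξ 2 → ℝ≥0) : Prop where
  measurable : Measurable T
  markov : ∀ᵐ (x : NetClass Ξ 1) ∂μ, ∀ v : x.G.V, outflow T x.G v = 1 ∧
    ∀ z : x.G.V, z ∉ S.carrier x.G → T (x.G.cls₂ v z) = 0

/-- The conditional expectation of `M = T⁻_G(o)` given the invariant sigma-field. -/
noncomputable def condMass (μ : Measure (NetClass Ξ 1)) (T : NetClass Ξ 2 → ℝ≥0) :
    NetClass Ξ 1 → ℝ≥0∞ :=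
  condLExp (NetClass.invariant Ξ) μ fun x => inflow T x.G x.o

/-- The measure `P'_T` is defined, i.e. `0 < E[M | I] < ∞` almost surely, it is a
probability measure, and it is equal to `P`. -/
structure IsPT' (μ : Measure (NetClass Ξ 1)) (T : NetClass Ξ 2 → ℝ≥0)
    (P : Measure (NetClass Ξ 1)) : Prop where
  pos : ∀ᵐ x ∂μ, 0 < condMass μ T x
  lt_top : ∀ᵐ x ∂μ, condMass μ T x < ∞
  isProbabilityMeasure : IsProbabilityMeasure P
  apply_eq : ∀ A : Set (NetClass Ξ 1), MeasurableSet A →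
    P A = ∫⁻ x, (condMass μ T x)⁻¹ *
      ∑' v : x.G.V, (T (x.G.cls₂ v x.o) : ℝ≥0∞) * A.indicator 1 (x.G.cls₁ v) ∂μ

/-- `ν` is obtained by biasing `P` by the function `w`. -/
structure IsBiasing (P : Measure (NetClass Ξ 1)) (w : NetClass Ξ 1 → ℝ≥0)
    (ν : Measure (NetClass Ξ 1)) : Prop where
  measurable : Measurable w
  pos : 0 < ∫⁻ x, (w x : ℝ≥0∞) ∂P
  lt_top : ∫⁻ x, (w x : ℝ≥0∞) ∂P < ∞
  eq : ν = (∫⁻ x, (w x : ℝ≥0∞) ∂P)⁻¹ • P.withDensity fun x => (w x : ℝ≥0∞)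

end

/-! Existence. Invariant events are exactly the `π`-preimages of events in `J`, so an invariant
event is almost sure under `μ` if and only if it is almost sure under a unimodularization `ν`
(`IsUnimodularization.ae_mem_iff`). It therefore suffices to build `T` under `ν`, where mass
transport holds on all vertices. `S` is nonempty `ν`-almost surely, and `exists_invariant_density`
gives an invariant `c` with conditional mean of `c · 1_S` equal to one. A greedy scheme
(`exists_greedy_transport`) ships unit supply at every vertex towards demand `c · 1_S`; no network
can keep both unused supply and unmet demand, and mass transport then excludes each of them
(`exists_balanced_transport`). The outcome, outflow one and inflow `c · 1_S` at all vertices, is an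
invariant event and so passes to `μ`. There `M = c` is its own conditional expectation, so `P'_T`
exists.

Every unimodularization is a biasing. Carrying both ends of a transport `g` to `S` by `T` turns mass
transport on `S` into mass transport for `P'_T` (`isUnimodular_of_isPT'`). An invariant `P'_T`-null
event is `μ`-null, hence `ν`-null. In a unimodular network everything shows at the root
(`IsUnimodular.ae_mem_allRoots`), which upgrades this to `ν ≪ P'_T`. The density between two
unimodular measures does not depend on the root: otherwise mass sent from higher to lower density
would violate mass transport for one of them (`ae_mem_allRoots_density`).

All this needs sums over vertices to be Borel for the local topology (`measurable_vsum`), which the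
first third of the file establishes. -/

namespace MarkedGraph

variable {Ξ : Type*}

/-! ### Isomorphisms of induced subnetworks -/

theorem induce_ends_eq_iff (G : MarkedGraph Ξ) {s : Set G.V} (e : (G.induce s).E)
    (u v : (G.induce s).V) : (G.induce s).ends e = s(u, v) ↔ G.ends e.1 = s(u.1, v.1) := by
  have h : ((G.induce s).ends e).map Subtype.val = G.ends e.1 :=
    Sym2.attachWith_map_subtypeVal e.2
  rw [← h]
  constructor
  · intro h; rw [h]; rfl
  · intro h
    exact Sym2.map.injective Subtype.val_injective h

theorem mem_induce_ends (G : MarkedGraph Ξ) {s : Set G.V} (e : (G.induce s).E)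
    (v : (G.induce s).V) : v ∈ (G.induce s).ends e ↔ v.1 ∈ G.ends e.1 := by
  have h : ((G.induce s).ends e).map Subtype.val = G.ends e.1 :=
    Sym2.attachWith_map_subtypeVal e.2
  rw [← h]
  constructor
  · intro h; exact Sym2.mem_map.2 ⟨v, h, rfl⟩
  · intro h
    obtain ⟨w, hw, h⟩ := Sym2.mem_map.1 h
    have : w = v := Subtype.val_injective h
    rwa [← this]

theorem adj_iff (G : MarkedGraph Ξ) (u v : G.V) :
    G.graph.Adj u v ↔ u ≠ v ∧ ∃ e, G.ends e = s(u, v) := by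
  unfold graph
  rw [SimpleGraph.fromRel_adj, Sym2.eq_swap (a := v), or_self]

namespace IsoUpTo

variable {R R' R'' : Ξ → Ξ → Prop} {G H K : MarkedGraph Ξ}

theorem mem_ends (φ : IsoUpTo R G H) {v : G.V} {e : G.E} :
    φ.toV v ∈ H.ends (φ.toE e) ↔ v ∈ G.ends e := by
  rw [φ.map_ends, Sym2.mem_map]
  constructor
  · rintro ⟨w, hw, h⟩; rwa [← φ.toV.injective h]
  · intro h; exact ⟨v, h, rfl⟩

theorem exists_ends (φ : IsoUpTo R G H) (u v : G.V) :
    (∃ e, G.ends e = s(u, v)) ↔ ∃ e, H.ends e = s(φ.toV u, φ.toV v) := by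
  constructor
  · rintro ⟨e, he⟩
    exact ⟨φ.toE e, by rw [φ.map_ends, he]; rfl⟩
  · rintro ⟨e, he⟩
    obtain ⟨e, rfl⟩ := φ.toE.surjective e
    refine ⟨e, ?_⟩
    rw [φ.map_ends] at he
    exact Sym2.map.injective φ.toV.injective he

/-- Composition of isomorphisms up to errors. -/
def comp (φ : IsoUpTo R G H) (ψ : IsoUpTo R' H K)
    (hR : ∀ x y z, R x y → R' y z → R'' x z) : IsoUpTo R'' G K where
  toV := φ.toV.trans ψ.toV
  toE := φ.toE.trans ψ.toE
  map_ends e := by simp [ψ.map_ends, φ.map_ends, Sym2.map_map]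
  vmark_rel v := hR _ _ _ (φ.vmark_rel v) (ψ.vmark_rel _)
  emark_rel v e h h' :=
    hR _ _ _ (φ.emark_rel v e h (φ.mem_ends.2 h)) (ψ.emark_rel _ _ (φ.mem_ends.2 h) h')

/-- Weakening of the relation between the marks. -/
def weaken (φ : IsoUpTo R G H) (hV : ∀ v, R' (G.vmark v) (H.vmark (φ.toV v)))
    (hE : ∀ v e (h : v ∈ G.ends e) (h' : φ.toV v ∈ H.ends (φ.toE e)),
      R' (G.emark v e h) (H.emark (φ.toV v) (φ.toE e) h')) : IsoUpTo R' G H where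
  toV := φ.toV
  toE := φ.toE
  map_ends := φ.map_ends
  vmark_rel := hV
  emark_rel := hE

/-- An isomorphism of networks as an isomorphism of the subnetworks induced by all vertices. -/
def induceUniv (φ : IsoUpTo R G H) :
    IsoUpTo R (G.induce Set.univ) (H.induce Set.univ) where
  toV := (Equiv.Set.univ _).trans (φ.toV.trans (Equiv.Set.univ _).symm)
  toE := (Equiv.subtypeUnivEquiv fun _ _ _ => trivial).trans
    (φ.toE.trans (Equiv.subtypeUnivEquiv fun _ _ _ => trivial).symm)
  map_ends e := by
    obtain ⟨⟨a, b⟩, hab⟩ := Sym2.mk_surjective ((G.induce Set.univ).ends e)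
    change s(a, b) = _ at hab
    rw [← hab]
    refine (induce_ends_eq_iff _ _ _ _).2 ((φ.map_ends e.1).trans ?_)
    rw [(induce_ends_eq_iff _ _ _ _).1 hab.symm]
    rfl
  vmark_rel v := φ.vmark_rel v.1
  emark_rel v e h h' := φ.emark_rel v.1 e.1 _ _

/-- A condition on vertices suffices: an edge lies in an induced subnetwork as soon as its endpoints
do, so the edge bijection restricts along with the vertex bijection. -/
theorem exists_restrict {s s' : Set G.V} {t t' : Set H.V}
    (φ : IsoUpTo R (G.induce s) (H.induce t)) (hs : s' ⊆ s) (ht : t' ⊆ t)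
    (h : ∀ v : (G.induce s).V, v.1 ∈ s' ↔ (φ.toV v).1 ∈ t') :
    ∃ ψ : IsoUpTo R (G.induce s') (H.induce t'),
      ∀ v : (G.induce s').V, (ψ.toV v).1 = (φ.toV ⟨v.1, hs v.2⟩).1 := by
  have key : ∀ e : (G.induce s).E,
      (∀ v ∈ G.ends e.1, v ∈ s') ↔ ∀ v ∈ H.ends (φ.toE e).1, v ∈ t' := by
    intro e
    constructor
    · intro he w hw
      obtain ⟨v, hv⟩ := φ.toV.surjective ⟨w, (φ.toE e).2 w hw⟩
      have hw' : φ.toV v ∈ (H.induce t).ends (φ.toE e) := by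
        rw [mem_induce_ends, hv]; exact hw
      rw [φ.mem_ends, mem_induce_ends] at hw'
      have := (h v).1 (he _ hw')
      rwa [hv] at this
    · intro he w hw
      obtain ⟨v, hv⟩ : ∃ v : (G.induce s).V, v.1 = w := ⟨⟨w, e.2 w hw⟩, rfl⟩
      subst hv
      have hw' : v ∈ (G.induce s).ends e := (mem_induce_ends _ _ _).2 hw
      rw [← φ.mem_ends, mem_induce_ends] at hw'
      exact (h v).2 (he _ hw')
  let iV : (G.induce s').V → (G.induce s).V := fun v => ⟨v.1, hs v.2⟩
  let iE : (G.induce s').E → (G.induce s).E := fun e => ⟨e.1, fun v hv => hs (e.2 v hv)⟩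
  let fV : (G.induce s').V → (H.induce t').V := fun v => ⟨(φ.toV (iV v)).1, (h (iV v)).1 v.2⟩
  have hfV : Function.Bijective fV := by
    constructor
    · intro a b hab
      have h1 : iV a = iV b := φ.toV.injective (Subtype.ext (congrArg (fun v => v.1) hab))
      exact Subtype.ext (congrArg (fun v => v.1) h1)
    · rintro ⟨w, hw⟩
      obtain ⟨v, hv⟩ := φ.toV.surjective ⟨w, ht hw⟩
      have hv' : (φ.toV v).1 = w := by rw [hv]
      exact ⟨⟨v.1, (h v).2 (by rw [hv']; exact hw)⟩, Subtype.ext hv'⟩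
  let fE : (G.induce s').E → (H.induce t').E := fun e => ⟨(φ.toE (iE e)).1, (key _).1 e.2⟩
  have hfE : Function.Bijective fE := by
    constructor
    · intro a b hab
      have h1 : iE a = iE b := φ.toE.injective (Subtype.ext (congrArg (fun v => v.1) hab))
      exact Subtype.ext (congrArg (fun v => v.1) h1)
    · rintro ⟨w, hw⟩
      obtain ⟨v, hv⟩ := φ.toE.surjective ⟨w, fun a ha => ht (hw a ha)⟩
      have hv' : (φ.toE v).1 = w := by rw [hv]
      exact ⟨⟨v.1, (key v).2 (by rw [hv']; exact hw)⟩, Subtype.ext hv'⟩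
  refine ⟨{ toV := Equiv.ofBijective fV hfV
            toE := Equiv.ofBijective fE hfE
            map_ends := ?_
            vmark_rel := fun v => φ.vmark_rel (iV v)
            emark_rel := fun v e hve hve' => φ.emark_rel (iV v) (iE e)
              ((mem_induce_ends _ _ _).2 ((mem_induce_ends _ e v).1 hve))
              ((mem_induce_ends _ (φ.toE (iE e)) (φ.toV (iV v))).2
                ((mem_induce_ends _ (fE e) (fV v)).1 hve')) },
    fun v => rfl⟩
  · intro e
    obtain ⟨⟨a, b⟩, hab⟩ := Sym2.mk_surjective ((G.induce s').ends e)
    change s(a, b) = _ at hab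
    rw [← hab]
    refine (induce_ends_eq_iff _ (fE e) (fV a) (fV b)).2 ?_
    have h2 : (G.induce s).ends (iE e) = s(iV a, iV b) :=
      (induce_ends_eq_iff _ _ _ _).2 ((induce_ends_eq_iff _ e a b).1 hab.symm)
    have h3 := φ.map_ends (iE e)
    rw [h2] at h3
    exact (induce_ends_eq_iff _ (φ.toE (iE e)) (φ.toV (iV a)) (φ.toV (iV b))).1 h3

end IsoUpTo

end MarkedGraph

/-! ### Balls and local closeness -/

namespace RootedNetwork

variable {Ξ : Type*} {n m : ℕ}

theorem mem_ball_zero (x : RootedNetwork Ξ n) (v : x.net.V) :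
    v ∈ x.ball 0 ↔ ∃ i, x.root i = v := by
  unfold ball
  simp only [Set.mem_ofPred_eq, Nat.le_zero]
  exact exists_congr fun i => (x.net.connected.preconnected _ _).dist_eq_zero_iff

/-- Growing balls by adjacency avoids distances in the whole network, which an isomorphism of
induced subnetworks need not visibly preserve. -/
theorem mem_ball_succ (x : RootedNetwork Ξ n) (k : ℕ) (v : x.net.V) :
    v ∈ x.ball (k + 1) ↔ v ∈ x.ball k ∨ ∃ u ∈ x.ball k, x.net.graph.Adj u v := by
  constructor
  · rintro ⟨i, hi⟩
    rcases hi.lt_or_eq with h | h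
    · exact Or.inl ⟨i, Nat.le_of_lt_succ h⟩
    · obtain ⟨p, hp⟩ := x.net.connected.exists_walk_length_eq_dist (x.root i) v
      have hnil : ¬ p.Nil := by
        intro hn
        have := SimpleGraph.Walk.length_eq_zero_iff.2 hn
        omega
      refine Or.inr ⟨p.penultimate, ⟨i, ?_⟩, p.adj_penultimate hnil⟩
      have h1 := SimpleGraph.dist_le p.dropLast
      simp at h1
      omega
  · rintro (⟨i, hi⟩ | ⟨u, ⟨i, hi⟩, hu⟩)
    · exact ⟨i, by omega⟩
    · refine ⟨i, ?_⟩
      have h1 := x.net.connected.dist_triangle (u := x.root i) (v := u) (w := v)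
      have h2 := SimpleGraph.dist_eq_one_iff_adj.2 hu
      omega

theorem ball_mono (x : RootedNetwork Ξ n) {k l : ℕ} (h : k ≤ l) : x.ball k ⊆ x.ball l :=
  fun _ ⟨i, hi⟩ => ⟨i, hi.trans h⟩

theorem root_mem_ball (x : RootedNetwork Ξ n) (k : ℕ) (i : Fin n) : x.root i ∈ x.ball k :=
  ⟨i, by simp⟩

theorem finite_ball (x : RootedNetwork Ξ n) (k : ℕ) : (x.ball k).Finite := by
  induction k with
  | zero =>
    refine (Set.finite_range x.root).subset fun v hv => ?_
    exact (mem_ball_zero x v).1 hv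
  | succ k ih =>
    have h1 : (⋃ u ∈ x.ball k, ⋃ e ∈ {e | u ∈ x.net.ends e}, {v | v ∈ x.net.ends e}).Finite := by
      refine ih.biUnion fun u _ => (x.net.locallyFinite u).biUnion fun e _ => ?_
      obtain ⟨⟨a, b⟩, hab⟩ := Sym2.mk_surjective (x.net.ends e)
      rw [← hab]
      refine (Set.toFinite {a, b}).subset fun v hv => ?_
      simpa using hv
    refine (ih.union h1).subset fun v hv => ?_
    rcases (mem_ball_succ x k v).1 hv with h | ⟨u, hu, huv⟩
    · exact Or.inl h
    · obtain ⟨-, e, he⟩ := (x.net.adj_iff u v).1 huv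
      refine Or.inr ?_
      simp only [Set.mem_iUnion]
      exact ⟨u, hu, e, by simp [he], by simp [he]⟩

/-- An isomorphism of induced subnetworks that contain the balls preserves the balls. -/
theorem mem_ball_iff_of_iso {R : Ξ → Ξ → Prop} {x y : RootedNetwork Ξ n} {s : Set x.net.V}
    {t : Set y.net.V} (φ : MarkedGraph.IsoUpTo R (x.net.induce s) (y.net.induce t)) {k : ℕ}
    (hs : x.ball k ⊆ s) (ht : y.ball k ⊆ t)
    (hr : ∀ i (h : x.root i ∈ s), (φ.toV ⟨x.root i, h⟩).1 = y.root i) :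
    ∀ j ≤ k, ∀ v : (x.net.induce s).V, v.1 ∈ x.ball j ↔ (φ.toV v).1 ∈ y.ball j := by
  intro j
  induction j with
  | zero =>
    intro _ v
    rw [mem_ball_zero, mem_ball_zero]
    refine exists_congr fun i => ?_
    have hi : x.root i ∈ s := hs (root_mem_ball x k i)
    rw [← hr i hi]
    constructor
    · intro h
      have : ⟨x.root i, hi⟩ = v := Subtype.ext h
      rw [this]
    · intro h
      exact congrArg (fun v => v.1) (φ.toV.injective (Subtype.ext h))
  | succ j ih =>
    intro hj v
    have ih := ih (by omega)
    rw [mem_ball_succ, mem_ball_succ, ← ih v]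
    -- An edge between two vertices of `s` or `t` automatically belongs to the induced subnetwork,
    -- so adjacency in the whole networks transfers.
    have adj : ∀ u : (x.net.induce s).V,
        x.net.graph.Adj u.1 v.1 ↔ y.net.graph.Adj (φ.toV u).1 (φ.toV v).1 := by
      intro u
      rw [MarkedGraph.adj_iff, MarkedGraph.adj_iff]
      refine and_congr (not_congr ⟨fun h => ?_, fun h => ?_⟩) ?_
      · rw [show u = v from Subtype.ext h]
      · rw [φ.toV.injective (Subtype.ext h)]
      · have h := φ.exists_ends u v
        rw [exists_congr fun e => MarkedGraph.induce_ends_eq_iff _ e _ _,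
          exists_congr fun e => MarkedGraph.induce_ends_eq_iff _ e _ _] at h
        constructor
        · rintro ⟨e, he⟩
          have hes : ∀ w ∈ x.net.ends e, w ∈ s := by
            intro w hw
            rw [he, Sym2.mem_iff] at hw
            rcases hw with rfl | rfl
            exacts [u.2, v.2]
          obtain ⟨e', he'⟩ := h.1 ⟨⟨e, hes⟩, he⟩
          exact ⟨e'.1, he'⟩
        · rintro ⟨e, he⟩
          have hes : ∀ w ∈ y.net.ends e, w ∈ t := by
            intro w hw
            rw [he, Sym2.mem_iff] at hw
            rcases hw with rfl | rfl
            exacts [(φ.toV u).2, (φ.toV v).2]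
          obtain ⟨e', he'⟩ := h.2 ⟨⟨e, hes⟩, he⟩
          exact ⟨e'.1, he'⟩
    refine or_congr_right ⟨?_, ?_⟩
    · rintro ⟨u, hu, huv⟩
      have hus : u ∈ s := hs (ball_mono x (by omega) hu)
      exact ⟨_, (ih ⟨u, hus⟩).1 hu, (adj ⟨u, hus⟩).1 huv⟩
    · rintro ⟨u, hu, huv⟩
      have hut : u ∈ t := ht (ball_mono y (by omega) hu)
      obtain ⟨w, hw⟩ := φ.toV.surjective ⟨u, hut⟩
      have hw' : (φ.toV w).1 = u := by rw [hw]
      rw [← hw'] at hu huv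
      exact ⟨_, (ih w).2 hu, (adj w).2 huv⟩

/-- The isomorphism `φ` of induced subnetworks restricts to the balls around other roots. -/
theorem exists_iso_ball {R : Ξ → Ξ → Prop} {x y : RootedNetwork Ξ n} {s : Set x.net.V}
    {t : Set y.net.V} (φ : MarkedGraph.IsoUpTo R (x.net.induce s) (y.net.induce t)) {k : ℕ}
    (hs : x.ball k ⊆ s) (ht : y.ball k ⊆ t)
    (hr : ∀ i (h : x.root i ∈ s), (φ.toV ⟨x.root i, h⟩).1 = y.root i) :
    ∃ ψ : MarkedGraph.IsoUpTo R (x.net.induce (x.ball k)) (y.net.induce (y.ball k)),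
      ∀ i (h : x.root i ∈ x.ball k), (ψ.toV ⟨x.root i, h⟩).1 = y.root i := by
  obtain ⟨ψ, hψ⟩ := φ.exists_restrict hs ht (mem_ball_iff_of_iso φ hs ht hr k le_rfl)
  exact ⟨ψ, fun i h => (hψ ⟨x.root i, h⟩).trans (hr i _)⟩

theorem exists_iso_ball_of_equiv {x y : RootedNetwork Ξ n} (h : x ≈ y) (k : ℕ) :
    ∃ ψ : MarkedGraph.IsoUpTo (· = ·) (x.net.induce (x.ball k)) (y.net.induce (y.ball k)),
      ∀ i (h : x.root i ∈ x.ball k), (ψ.toV ⟨x.root i, h⟩).1 = y.root i := by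
  obtain ⟨φ, hφ⟩ := h
  exact exists_iso_ball φ.induceUniv (Set.subset_univ _) (Set.subset_univ _) fun i _ => hφ i

theorem finite_induce_ball (x : RootedNetwork Ξ n) (k : ℕ) :
    Finite (x.net.induce (x.ball k)).V ∧ Finite (x.net.induce (x.ball k)).E := by
  have hV : Finite (x.net.induce (x.ball k)).V := (finite_ball x k).to_subtype
  refine ⟨hV, ?_⟩
  have h : (⋃ v : (x.net.induce (x.ball k)).V, {e | v ∈ (x.net.induce (x.ball k)).ends e}).Finite :=
    Set.finite_iUnion fun v => (x.net.induce (x.ball k)).locallyFinite v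
  refine Set.finite_univ_iff.1 (h.subset fun e _ => ?_)
  obtain ⟨⟨a, b⟩, hab⟩ := Sym2.mk_surjective ((x.net.induce (x.ball k)).ends e)
  refine Set.mem_iUnion.2 ⟨a, ?_⟩
  change a ∈ (x.net.induce (x.ball k)).ends e
  rw [← hab]
  simp

variable [MetricSpace Ξ]

theorem IsClose.mono {x y : RootedNetwork Ξ n} {k l : ℕ} {ε δ : ℝ} (h : x.IsClose l δ y)
    (hkl : k ≤ l) (hε : δ ≤ ε) : x.IsClose k ε y := by
  obtain ⟨φ, hφ⟩ := h
  obtain ⟨ψ, hψ⟩ := exists_iso_ball φ (ball_mono x hkl) (ball_mono y hkl) hφ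
  exact ⟨ψ.weaken (fun v => (ψ.vmark_rel v).trans_le hε)
    fun v e h h' => (ψ.emark_rel v e h h').trans_le hε, hψ⟩

theorem isClose_refl (x : RootedNetwork Ξ n) (k : ℕ) {ε : ℝ} (hε : 0 < ε) : x.IsClose k ε x :=
  ⟨(MarkedGraph.Iso.refl _).weaken (fun v => by simpa [MarkedGraph.Iso.refl] using hε)
    fun v e h h' => by simpa [MarkedGraph.Iso.refl] using hε, fun i h => rfl⟩

theorem IsClose.trans_equiv {x y z : RootedNetwork Ξ n} {k : ℕ} {ε : ℝ} (h : x.IsClose k ε y)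
    (hyz : y ≈ z) : x.IsClose k ε z := by
  obtain ⟨φ, hφ⟩ := h
  obtain ⟨ψ, hψ⟩ := exists_iso_ball_of_equiv hyz k
  refine ⟨φ.comp ψ ?_, fun i h => ?_⟩
  · rintro a b c h rfl; exact h
  · change (ψ.toV (φ.toV ⟨x.root i, h⟩)).1 = z.root i
    rw [← hψ i (root_mem_ball y k i)]
    congr 2
    exact Subtype.ext (hφ i h)

/-- Being close to a given network is an open condition. -/
theorem IsClose.exists_isClose {x y : RootedNetwork Ξ n} {k : ℕ} {ε : ℝ} (h : x.IsClose k ε y) :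
    ∃ δ > 0, ∀ z, y.IsClose k δ z → x.IsClose k ε z := by
  obtain ⟨φ, hφ⟩ := h
  obtain ⟨hV, hE⟩ := finite_induce_ball x k
  -- Balls are finite, so the finitely many strict inequalities between marks leave a common margin
  -- `δ`.
  have lim : ∀ r < ε, ∀ᶠ δ in nhdsWithin (0 : ℝ) (Set.Ioi 0), r + δ ≤ ε := by
    intro r hr
    have h1 : Set.Ioo (0 : ℝ) (ε - r) ∈ nhdsWithin (0 : ℝ) (Set.Ioi 0) :=
      Ioo_mem_nhdsGT (by linarith)
    filter_upwards [h1] with δ hδ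
    linarith [hδ.2]
  have h1 : ∀ᶠ δ in nhdsWithin (0 : ℝ) (Set.Ioi 0), ∀ v,
      dist ((x.net.induce (x.ball k)).vmark v) ((y.net.induce (y.ball k)).vmark (φ.toV v)) + δ ≤ ε :=
    Filter.eventually_all.2 fun v => lim _ (φ.vmark_rel v)
  have h2 : ∀ᶠ δ in nhdsWithin (0 : ℝ) (Set.Ioi 0), ∀ v e
      (h : v ∈ (x.net.induce (x.ball k)).ends e)
      (h' : φ.toV v ∈ (y.net.induce (y.ball k)).ends (φ.toE e)),
      dist ((x.net.induce (x.ball k)).emark v e h)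
        ((y.net.induce (y.ball k)).emark (φ.toV v) (φ.toE e) h') + δ ≤ ε :=
    Filter.eventually_all.2 fun v => Filter.eventually_all.2 fun e =>
      Filter.eventually_all.2 fun h => Filter.eventually_all.2 fun h' => lim _ (φ.emark_rel v e h h')
  obtain ⟨δ, ⟨h1, h2⟩, hδ⟩ := ((h1.and h2).and self_mem_nhdsWithin).exists
  refine ⟨δ, hδ, ?_⟩
  rintro z ⟨ψ, hψ⟩
  -- With the trivial relation the composition records only the combinatorics; the bounds on marks
  -- come afterwards from the triangle inequality and depend on the individual vertex or edge.
  refine ⟨(φ.comp (R'' := fun _ _ => True) ψ fun _ _ _ _ _ => trivial).weaken ?_ ?_, fun i h => ?_⟩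
  · intro v
    exact (dist_triangle _ _ _).trans_lt
      ((add_lt_add_right (ψ.vmark_rel (φ.toV v)) _).trans_le (h1 v))
  · intro v e h h'
    exact (dist_triangle _ _ _).trans_lt
      ((add_lt_add_right (ψ.emark_rel (φ.toV v) (φ.toE e) (φ.mem_ends.2 h) h') _).trans_le
        (h2 v e h (φ.mem_ends.2 h)))
  · change (ψ.toV (φ.toV ⟨x.root i, h⟩)).1 = z.root i
    rw [← hψ i (root_mem_ball y k i)]
    congr 2
    exact Subtype.ext (hφ i h)

end RootedNetwork

/-- Monotone convergence for the counting measure; with all subsets measurable, no countability of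
`α` is needed. -/
theorem ENNReal.tsum_iSup_of_monotone {α : Type*} {f : ℕ → α → ℝ≥0∞} (hf : Monotone f) :
    ∑' a, ⨆ n, f n a = ⨆ n, ∑' a, f n a := by
  let : MeasurableSpace α := ⊤
  simp only [← lintegral_count]
  exact lintegral_iSup (fun n => measurable_from_top) hf

/-! ### Changing the tuple of roots -/

namespace RootedNetwork

variable {Ξ : Type*} {n m : ℕ}

/-- Replace the roots by some of them. -/
def reindex (f : Fin m → Fin n) (x : RootedNetwork Ξ n) : RootedNetwork Ξ m := ⟨x.net, x.root ∘ f⟩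

/-- Add a vertex in front of the roots. -/
def cons (x : RootedNetwork Ξ n) (v : x.net.V) : RootedNetwork Ξ (n + 1) :=
  ⟨x.net, Matrix.vecCons v x.root⟩

theorem ball_reindex (f : Fin m → Fin n) (x : RootedNetwork Ξ n) (k : ℕ) :
    (x.reindex f).ball k ⊆ x.ball k :=
  fun _ ⟨i, hi⟩ => ⟨f i, hi⟩

theorem ball_cons (x : RootedNetwork Ξ n) {v : x.net.V} {d : ℕ} (hv : v ∈ x.ball d) (k : ℕ) :
    (x.cons v).ball k ⊆ x.ball (k + d) := by
  rintro w ⟨i, hi⟩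
  induction i using Fin.cases with
  | zero =>
    obtain ⟨j, hj⟩ := hv
    have h := x.net.connected.dist_triangle (u := x.root j) (v := v) (w := w)
    have hi' : x.net.graph.dist v w ≤ k := hi
    exact ⟨j, by omega⟩
  | succ i => exact ⟨i, le_trans hi (by omega)⟩

/-- The first root is at distance at most `k` from one of the other roots. -/
def Near (k : ℕ) (x : RootedNetwork Ξ (n + 1)) : Prop :=
  x.root 0 ∈ (x.reindex Fin.succ).ball k

theorem exists_mem_ball [NeZero n] (x : RootedNetwork Ξ n) (v : x.net.V) : ∃ k, v ∈ x.ball k :=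
  ⟨_, 0, le_rfl⟩

variable [MetricSpace Ξ]

theorem IsClose.reindex (f : Fin m → Fin n) {x y : RootedNetwork Ξ n} {k : ℕ} {ε : ℝ}
    (h : x.IsClose k ε y) : (x.reindex f).IsClose k ε (y.reindex f) := by
  obtain ⟨φ, hφ⟩ := h
  exact exists_iso_ball (x := x.reindex f) (y := y.reindex f) φ (ball_reindex f x k)
    (ball_reindex f y k) fun i h => hφ (f i) h

/-- The ball around the other roots lies inside the ball around all roots, where the isomorphism
sees it; the marks play no role. This is what makes `nearSet` open. -/
theorem Near.of_isClose {x y : RootedNetwork Ξ (n + 1)} {k : ℕ} {ε : ℝ} (hx : x.Near k)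
    (h : x.IsClose k ε y) : y.Near k := by
  obtain ⟨φ, hφ⟩ := h
  have h1 := mem_ball_iff_of_iso (x := x.reindex Fin.succ) (y := y.reindex Fin.succ) φ
    (ball_reindex _ x k) (ball_reindex _ y k) (fun i h => hφ _ h) k le_rfl
    ⟨x.root 0, root_mem_ball x k 0⟩
  have h2 : y.root 0 = _ := (hφ 0 (root_mem_ball x k 0)).symm
  unfold Near
  rw [h2]
  exact h1.1 hx

end RootedNetwork

/-! ### The local topology and measurability of sums over vertices -/

namespace NetClass

open RootedNetwork

variable {Ξ : Type*} {n m : ℕ}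

/-- The class of a network with roots. -/
def mk (x : RootedNetwork Ξ n) : NetClass Ξ n := Quotient.mk _ x

theorem mk_eq_mk {x y : RootedNetwork Ξ n} : mk x = mk y ↔ x ≈ y := Quotient.eq

theorem mk_surjective (q : NetClass Ξ n) : ∃ x, mk x = q := Quotient.exists_rep q

/-- Replace the roots by some of them. -/
def reindex (f : Fin m → Fin n) : NetClass Ξ n → NetClass Ξ m :=
  Quotient.map (RootedNetwork.reindex f) fun _ _ ⟨φ, hφ⟩ => ⟨φ, fun i => hφ (f i)⟩

/-- The sum of `g` over all positions of the first root. -/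
noncomputable def vsum (g : NetClass Ξ (n + 1) → ℝ≥0∞) : NetClass Ξ n → ℝ≥0∞ :=
  Quotient.lift (fun x => ∑' v, g (mk (x.cons v))) (by
    rintro x y ⟨φ, hφ⟩
    refine Eq.trans (tsum_congr fun v => ?_) (φ.toV.tsum_eq fun v => g (mk (y.cons v)))
    exact congrArg g (mk_eq_mk.2 ⟨φ, Fin.cases rfl hφ⟩))

theorem vsum_mk (g : NetClass Ξ (n + 1) → ℝ≥0∞) (x : RootedNetwork Ξ n) :
    vsum g (mk x) = ∑' v, g (mk (x.cons v)) := rfl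

/-- Classes in which the first root is at distance at most `k` from one of the other roots. -/
def nearSet (Ξ : Type*) (n k : ℕ) : Set (NetClass Ξ (n + 1)) :=
  {q | ∃ x : RootedNetwork Ξ (n + 1), x.Near k ∧ mk x = q}

theorem vsum_mono {f g : NetClass Ξ (n + 1) → ℝ≥0∞} (h : f ≤ g) : vsum f ≤ vsum g := by
  intro q
  obtain ⟨x, rfl⟩ := mk_surjective q
  exact ENNReal.tsum_le_tsum fun v => h _

theorem vsum_tsum {ι : Type*} (f : ι → NetClass Ξ (n + 1) → ℝ≥0∞) (q : NetClass Ξ n) :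
    vsum (fun y => ∑' i, f i y) q = ∑' i, vsum (f i) q := by
  obtain ⟨x, rfl⟩ := mk_surjective q
  exact ENNReal.tsum_comm

theorem vsum_add (f g : NetClass Ξ (n + 1) → ℝ≥0∞) : vsum (f + g) = vsum f + vsum g := by
  funext q
  obtain ⟨x, rfl⟩ := mk_surjective q
  exact ENNReal.tsum_add

theorem vsum_iSup {f : ℕ → NetClass Ξ (n + 1) → ℝ≥0∞} (hf : Monotone f) (q : NetClass Ξ n) :
    vsum (fun y => ⨆ i, f i y) q = ⨆ i, vsum (f i) q := by
  obtain ⟨x, rfl⟩ := mk_surjective q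
  exact ENNReal.tsum_iSup_of_monotone fun i j h v => hf h _

theorem vsum_mul_left (g : NetClass Ξ n → ℝ≥0∞) (f : NetClass Ξ (n + 1) → ℝ≥0∞)
    (q : NetClass Ξ n) :
    vsum (fun y => g (reindex Fin.succ y) * f y) q = g q * vsum f q := by
  obtain ⟨x, rfl⟩ := mk_surjective q
  exact ENNReal.tsum_mul_left (a := g (mk x)) (f := fun v => f (mk (x.cons v)))

variable [MetricSpace Ξ]

theorem mk_mem_nearSet {k : ℕ} {x : RootedNetwork Ξ (n + 1)} :
    mk x ∈ nearSet Ξ n k ↔ x.Near k := by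
  constructor
  · rintro ⟨y, hy, h⟩
    exact hy.of_isClose ((isClose_refl y k one_pos).trans_equiv (mk_eq_mk.1 h))
  · exact fun h => ⟨x, h, rfl⟩

section Topology

variable [NeZero n] [NeZero m]

/-- The topology is generated by closeness sets centred anywhere; `IsClose.exists_isClose` recentres
them at a given point, and intersections are absorbed by a larger `k` and a smaller `ε`. With
`isOpen_of_isClose` this describes open sets by closeness alone. -/
theorem exists_isClose_of_isOpen {U : Set (NetClass Ξ n)} (hU : IsOpen U)
    {x : RootedNetwork Ξ n} (hx : mk x ∈ U) :
    ∃ (k : ℕ) (ε : ℝ), 0 < ε ∧ ∀ y, x.IsClose k ε y → mk y ∈ U := by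
  induction hU with
  | basic U hU =>
    obtain ⟨z, k, ε, -, rfl⟩ := hU
    obtain ⟨y, hy, hzy⟩ := hx
    obtain ⟨δ, hδ, h⟩ := (hzy.trans_equiv (mk_eq_mk.1 hy)).exists_isClose
    exact ⟨k, δ, hδ, fun y hy => ⟨y, rfl, h y hy⟩⟩
  | univ => exact ⟨0, 1, one_pos, fun _ _ => trivial⟩
  | inter U V _ _ ihU ihV =>
    obtain ⟨k, ε, hε, h⟩ := ihU hx.1
    obtain ⟨l, δ, hδ, h'⟩ := ihV hx.2
    exact ⟨max k l, min ε δ, lt_min hε hδ, fun y hy =>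
      ⟨h y (hy.mono (le_max_left _ _) (min_le_left _ _)),
        h' y (hy.mono (le_max_right _ _) (min_le_right _ _))⟩⟩
  | sUnion 𝒰 _ ih =>
    obtain ⟨U, hU, hxU⟩ := hx
    obtain ⟨k, ε, hε, h⟩ := ih U hU hxU
    exact ⟨k, ε, hε, fun y hy => ⟨U, hU, h y hy⟩⟩

theorem isOpen_of_isClose {U : Set (NetClass Ξ n)}
    (h : ∀ x, mk x ∈ U → ∃ (k : ℕ) (ε : ℝ), 0 < ε ∧ ∀ y, x.IsClose k ε y → mk y ∈ U) :
    IsOpen U := by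
  refine isOpen_iff_forall_mem_open.2 fun q hq => ?_
  obtain ⟨x, rfl⟩ := mk_surjective q
  obtain ⟨k, ε, hε, h⟩ := h x hq
  refine ⟨_, ?_, TopologicalSpace.isOpen_generateFrom_of_mem ⟨x, k, ε, hε, rfl⟩,
    ⟨x, rfl, isClose_refl x k hε⟩⟩
  rintro _ ⟨y, rfl, hy⟩
  exact h y hy

theorem continuous_reindex (f : Fin m → Fin n) :
    Continuous (reindex f : NetClass Ξ n → NetClass Ξ m) := by
  refine ⟨fun U hU => isOpen_of_isClose fun x hx => ?_⟩
  obtain ⟨k, ε, hε, h⟩ := exists_isClose_of_isOpen (x := x.reindex f) hU hx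
  exact ⟨k, ε, hε, fun y hy => h _ (hy.reindex f)⟩

theorem measurable_reindex (f : Fin m → Fin n) :
    Measurable (reindex f : NetClass Ξ n → NetClass Ξ m) :=
  (continuous_reindex f).measurable

end Topology

theorem isOpen_nearSet (k : ℕ) : IsOpen (nearSet Ξ n k) :=
  isOpen_of_isClose fun _ hx => ⟨k, 1, one_pos, fun _ hy =>
    mk_mem_nearSet.2 ((mk_mem_nearSet.1 hx).of_isClose hy)⟩

/-- The number of vertices `v` for which `[G, v, roots]` is in an open set is lower
semicontinuous. -/
theorem isOpen_lt_vsum [NeZero n] {A : Set (NetClass Ξ (n + 1))} (hA : IsOpen A) (t : ℝ≥0∞) :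
    IsOpen {q | t < vsum (A.indicator 1) q} := by
  classical
  refine isOpen_of_isClose fun x hx => ?_
  change t < vsum (A.indicator 1) (mk x) at hx
  rw [vsum_mk, ENNReal.tsum_eq_iSup_sum] at hx
  obtain ⟨F, hF⟩ := lt_iSup_iff.1 hx
  set F' := F.filter fun v => mk (x.cons v) ∈ A
  have hk : ∀ v ∈ F', ∃ (k : ℕ) (ε : ℝ), 0 < ε ∧ ∀ y, (x.cons v).IsClose k ε y → mk y ∈ A :=
    fun v hv => exists_isClose_of_isOpen hA (Finset.mem_filter.1 hv).2
  choose! k ε hε hk using hk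
  choose d hd using exists_mem_ball x
  -- The `k v`-ball around `v` and the roots lies in the `(k v + d v)`-ball around the roots, since
  -- `v` is within `d v` of one of them.
  let K := F'.sup fun v => k v + d v
  have hK : ∀ v ∈ F', k v + d v ≤ K := fun v hv => Finset.le_sup (f := fun v => k v + d v) hv
  obtain ⟨δ, hδF, hδ⟩ : ∃ δ : ℝ, (∀ v ∈ F', δ ≤ ε v) ∧ 0 < δ := by
    have h : ∀ᶠ δ in nhdsWithin (0 : ℝ) (Set.Ioi 0), ∀ v ∈ F', δ ≤ ε v := by
      refine (Finset.eventually_all F').2 fun v hv => ?_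
      filter_upwards [Ioo_mem_nhdsGT (hε v hv)] with δ hδ using hδ.2.le
    exact (h.and self_mem_nhdsWithin).exists
  refine ⟨K, δ, hδ, ?_⟩
  rintro y ⟨φ, hφ⟩
  have hball : ∀ v ∈ F', v ∈ x.ball K := fun v hv =>
    ball_mono x (le_trans (Nat.le_add_left _ _) (hK v hv)) (hd v)
  -- `φ` carries the finitely many counted vertices injectively to vertices counted for `y`, so the
  -- count of `y` is at least as large.
  let j : F' → y.net.V := fun v => (φ.toV ⟨v.1, hball v.1 v.2⟩).1
  have hj : Function.Injective j := fun v w h =>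
    Subtype.ext (congrArg (fun v => v.1) (φ.toV.injective (Subtype.ext h)))
  have hjA : ∀ v, mk (y.cons (j v)) ∈ A := by
    intro v
    refine hk v.1 v.2 _ ?_
    have hjd : j v ∈ y.ball (d v) :=
      (mem_ball_iff_of_iso φ le_rfl le_rfl hφ (d v)
        (le_trans (Nat.le_add_left _ _) (hK v v.2)) ⟨v.1, hball v.1 v.2⟩).1 (hd v)
    obtain ⟨ψ, hψ⟩ := exists_iso_ball (x := x.cons v.1) (y := y.cons (j v)) (k := k v) φ
      ((ball_cons x (hd v) _).trans (ball_mono x (hK v v.2)))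
      ((ball_cons y hjd _).trans (ball_mono y (hK v v.2)))
      (Fin.cases (fun _ => rfl) fun i h => hφ i h)
    exact ⟨ψ.weaken (fun w => (ψ.vmark_rel w).trans_le (hδF _ v.2))
      fun _ e h h' => (ψ.emark_rel _ e h h').trans_le (hδF _ v.2), hψ⟩
  change t < vsum (A.indicator 1) (mk y)
  rw [vsum_mk]
  calc t < ∑ v ∈ F, A.indicator 1 (mk (x.cons v)) := hF
    _ = ∑ v ∈ F', 1 := by
      rw [Finset.sum_filter]
      exact Finset.sum_congr rfl fun v _ => by simp [Set.indicator_apply]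
    _ = ∑' v : F', (1 : ℝ≥0∞) := by simp
    _ = ∑' v : F', A.indicator 1 (mk (y.cons (j v))) := by
      refine tsum_congr fun v => ?_
      rw [Set.indicator_of_mem (hjA v)]; rfl
    _ ≤ ∑' v, A.indicator 1 (mk (y.cons v)) :=
      ENNReal.tsum_comp_le_tsum_of_injective hj fun v => A.indicator 1 (mk (y.cons v))

theorem vsum_nearSet_lt_top (k : ℕ) (q : NetClass Ξ n) :
    vsum ((nearSet Ξ n k).indicator 1) q < ∞ := by
  obtain ⟨x, rfl⟩ := mk_surjective q
  rw [vsum_mk]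
  have h : ∀ v, (nearSet Ξ n k).indicator (1 : NetClass Ξ (n + 1) → ℝ≥0∞) (mk (x.cons v)) =
      (x.ball k).indicator 1 v := by
    intro v
    by_cases hv : v ∈ x.ball k
    · rw [Set.indicator_of_mem hv, Set.indicator_of_mem]
      · rfl
      · exact mk_mem_nearSet.2 hv
    · rw [Set.indicator_of_notMem hv, Set.indicator_of_notMem]
      exact fun h => hv (mk_mem_nearSet.1 h)
  simp only [h]
  have := (finite_ball x k).to_subtype
  rw [← tsum_subtype]
  have := Fintype.ofFinite (x.ball k)
  rw [tsum_fintype]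
  exact ENNReal.sum_lt_top.2 fun _ _ => ENNReal.one_lt_top

/-- Open sets give lower semicontinuous counts, and a π-λ argument extends this to Borel sets.
Truncating to `nearSet` keeps the counts finite, which the subtraction for complements requires. -/
theorem measurable_vsum_indicator_inter_nearSet [NeZero n] {A : Set (NetClass Ξ (n + 1))}
    (hA : MeasurableSet A) (k : ℕ) : Measurable (vsum ((A ∩ nearSet Ξ n k).indicator 1)) := by
  have hopen : ∀ A : Set (NetClass Ξ (n + 1)), IsOpen A →
      Measurable (vsum ((A ∩ nearSet Ξ n k).indicator 1)) := fun A hA =>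
    measurable_of_Ioi fun t => (isOpen_lt_vsum (hA.inter (isOpen_nearSet k)) t).measurableSet
  induction A, hA using MeasurableSpace.induction_on_inter
    (BorelSpace.measurable_eq (α := NetClass Ξ (n + 1))) isPiSystem_isOpen with
  | empty => exact hopen _ isOpen_empty
  | basic A hA => exact hopen _ hA
  | compl A _ ih =>
    have h : vsum ((Aᶜ ∩ nearSet Ξ n k).indicator 1) = fun q =>
        vsum ((Set.univ ∩ nearSet Ξ n k).indicator 1) q -
          vsum ((A ∩ nearSet Ξ n k).indicator 1) q := by
      funext q
      refine ENNReal.eq_sub_of_add_eq ?_ ?_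
      · refine ne_top_of_le_ne_top (vsum_nearSet_lt_top k q).ne (vsum_mono ?_ q)
        exact Set.indicator_le_indicator_of_subset Set.inter_subset_right fun _ => zero_le_one
      · rw [← Pi.add_apply, ← vsum_add]
        congr 1
        funext y
        by_cases h1 : y ∈ A <;> by_cases h2 : y ∈ nearSet Ξ n k <;> simp [h1, h2]
    rw [h]
    exact (hopen _ isOpen_univ).sub ih
  | iUnion f hd _ ih =>
    have h : vsum (((⋃ i, f i) ∩ nearSet Ξ n k).indicator 1) = fun q =>
        ∑' i, vsum ((f i ∩ nearSet Ξ n k).indicator 1) q := by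
      funext q
      rw [← vsum_tsum]
      congr 1
      funext y
      rw [Set.iUnion_inter]
      by_cases hy : ∃ i, y ∈ f i ∩ nearSet Ξ n k
      · obtain ⟨i, hi⟩ := hy
        rw [Set.indicator_of_mem (Set.mem_iUnion.2 ⟨i, hi⟩), tsum_eq_single i,
          Set.indicator_of_mem hi]
        exact fun j hj => Set.indicator_of_notMem
          (fun h => Set.disjoint_left.1 (hd hj) h.1 hi.1) _
      · rw [Set.indicator_of_notMem (by simpa using hy)]
        simp only [not_exists] at hy
        simp [hy]
    rw [h]
    exact Measurable.tsum ih

/-- Every vertex is at finite distance from some root, so the truncated counts increase to the full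
ones. -/
theorem measurable_vsum [NeZero n] {g : NetClass Ξ (n + 1) → ℝ≥0∞} (hg : Measurable g) :
    Measurable (vsum g) := by
  refine Measurable.ennreal_induction (motive := fun g => Measurable (vsum g)) ?_ ?_ ?_ hg
  · intro c A hA
    have h : vsum (A.indicator fun _ => c) = fun q =>
        c * ⨆ k, vsum ((A ∩ nearSet Ξ n k).indicator 1) q := by
      funext q
      rw [← vsum_iSup]
      · rw [← vsum_mul_left fun _ => c]
        congr 1
        funext y
        obtain ⟨x, rfl⟩ := mk_surjective y
        by_cases hy : mk x ∈ A
        · obtain ⟨k, hk⟩ := exists_mem_ball (x.reindex Fin.succ) (x.root 0)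
          rw [Set.indicator_of_mem hy]
          have h1 : ⨆ k, (A ∩ nearSet Ξ n k).indicator (1 : NetClass Ξ (n + 1) → ℝ≥0∞) (mk x) = 1 := by
            refine le_antisymm (iSup_le fun i => Set.indicator_le_self' (fun _ _ => zero_le_one) _) ?_
            refine le_iSup_of_le k ?_
            have hk' : mk x ∈ A ∩ nearSet Ξ n k := ⟨hy, mk_mem_nearSet.2 hk⟩
            rw [Set.indicator_of_mem hk']
            rfl
          rw [h1, mul_one]
        · rw [Set.indicator_of_notMem hy]
          simp [hy]
      · refine fun i j hij => Set.indicator_le_indicator_of_subset ?_ fun _ => zero_le_one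
        refine Set.inter_subset_inter_right _ ?_
        rintro _ ⟨x, hx, rfl⟩
        exact ⟨x, ball_mono _ hij hx, rfl⟩
    rw [h]
    exact measurable_const.mul
      (Measurable.iSup fun k => measurable_vsum_indicator_inter_nearSet hA k)
  · intro f g _ _ _ ihf ihg
    rw [vsum_add]
    exact ihf.add ihg
  · intro f _ hmono ih
    have h : vsum (fun y => ⨆ i, f i y) = fun q => ⨆ i, vsum (f i) q :=
      funext fun q => vsum_iSup hmono q
    rw [h]
    exact Measurable.iSup ih

end NetClass

/-! ### Mass transport and invariant events -/

namespace NetClass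

variable {Ξ : Type*}

/-- The class of the first root. -/
def fst : NetClass Ξ 2 → NetClass Ξ 1 := reindex ![0]

/-- The class of the second root. -/
def snd : NetClass Ξ 2 → NetClass Ξ 1 := reindex ![1]

/-- Exchange of the two roots. -/
def swap : NetClass Ξ 2 → NetClass Ξ 2 := reindex ![1, 0]

@[simp]
theorem fst_cls₂ (G : Network Ξ) (o v : G.V) : fst (G.cls₂ o v) = G.cls₁ o :=
  congrArg (fun r => mk ⟨G, r⟩) (funext fun i => by fin_cases i; rfl)

@[simp]
theorem snd_cls₂ (G : Network Ξ) (o v : G.V) : snd (G.cls₂ o v) = G.cls₁ v :=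
  congrArg (fun r => mk ⟨G, r⟩) (funext fun i => by fin_cases i; rfl)

@[simp]
theorem swap_cls₂ (G : Network Ξ) (o v : G.V) : swap (G.cls₂ o v) = G.cls₂ v o :=
  congrArg (fun r => mk ⟨G, r⟩) (funext fun i => by fin_cases i <;> rfl)

theorem exists_cls₁ (q : NetClass Ξ 1) : ∃ (G : Network Ξ) (o : G.V), q = G.cls₁ o :=
  ⟨q.G, q.o, q.cls₁_G_o.symm⟩

theorem exists_cls₂ (q : NetClass Ξ 2) : ∃ (G : Network Ξ) (o v : G.V), q = G.cls₂ o v := by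
  obtain ⟨⟨G, r⟩, rfl⟩ := mk_surjective q
  exact ⟨G, r 0, r 1, congrArg (fun r => mk ⟨G, r⟩) (funext fun i => by fin_cases i <;> rfl)⟩

/-- The mass that enters the root. -/
noncomputable def inn (g : NetClass Ξ 2 → ℝ≥0∞) : NetClass Ξ 1 → ℝ≥0∞ := vsum g

/-- The mass that leaves the root. -/
noncomputable def out (g : NetClass Ξ 2 → ℝ≥0∞) : NetClass Ξ 1 → ℝ≥0∞ := vsum (g ∘ swap)

theorem inn_cls₁ (g : NetClass Ξ 2 → ℝ≥0∞) (G : Network Ξ) (o : G.V) :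
    inn g (G.cls₁ o) = ∑' v, g (G.cls₂ v o) := rfl

theorem out_cls₁ (g : NetClass Ξ 2 → ℝ≥0∞) (G : Network Ξ) (o : G.V) :
    out g (G.cls₁ o) = ∑' v, g (G.cls₂ o v) :=
  tsum_congr fun v => congrArg g (swap_cls₂ G v o)

theorem inflow_eq (g : NetClass Ξ 2 → ℝ≥0) (G : Network Ξ) (o : G.V) :
    inflow g G o = inn (fun y => (g y : ℝ≥0∞)) (G.cls₁ o) := rfl

theorem outflow_eq (g : NetClass Ξ 2 → ℝ≥0) (G : Network Ξ) (o : G.V) :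
    outflow g G o = out (fun y => (g y : ℝ≥0∞)) (G.cls₁ o) :=
  (out_cls₁ (fun y => (g y : ℝ≥0∞)) G o).symm

theorem inn_snd_mul (f : NetClass Ξ 1 → ℝ≥0∞) (g : NetClass Ξ 2 → ℝ≥0∞) (q : NetClass Ξ 1) :
    inn (fun y => f (snd y) * g y) q = f q * inn g q := by
  obtain ⟨G, o, rfl⟩ := exists_cls₁ q
  simp only [inn_cls₁, snd_cls₂, ENNReal.tsum_mul_left]

theorem out_fst_mul (f : NetClass Ξ 1 → ℝ≥0∞) (g : NetClass Ξ 2 → ℝ≥0∞) (q : NetClass Ξ 1) :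
    out (fun y => f (fst y) * g y) q = f q * out g q := by
  obtain ⟨G, o, rfl⟩ := exists_cls₁ q
  simp only [out_cls₁, fst_cls₂, ENNReal.tsum_mul_left]

theorem inn_mono {f g : NetClass Ξ 2 → ℝ≥0∞} (h : f ≤ g) : inn f ≤ inn g := vsum_mono h

theorem out_mono {f g : NetClass Ξ 2 → ℝ≥0∞} (h : f ≤ g) : out f ≤ out g :=
  vsum_mono fun _ => h _

theorem inn_iSup {f : ℕ → NetClass Ξ 2 → ℝ≥0∞} (hf : Monotone f) (q : NetClass Ξ 1) :
    inn (fun y => ⨆ i, f i y) q = ⨆ i, inn (f i) q := vsum_iSup hf q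

theorem out_iSup {f : ℕ → NetClass Ξ 2 → ℝ≥0∞} (hf : Monotone f) (q : NetClass Ξ 1) :
    out (fun y => ⨆ i, f i y) q = ⨆ i, out (f i) q :=
  vsum_iSup (f := fun i => f i ∘ swap) (fun _ _ h _ => hf h _) q

theorem inn_tsum {α : Type*} (f : α → NetClass Ξ 2 → ℝ≥0∞) (q : NetClass Ξ 1) :
    inn (fun y => ∑' i, f i y) q = ∑' i, inn (f i) q := vsum_tsum f q

theorem out_tsum {α : Type*} (f : α → NetClass Ξ 2 → ℝ≥0∞) (q : NetClass Ξ 1) :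
    out (fun y => ∑' i, f i y) q = ∑' i, out (f i) q := vsum_tsum (fun i => f i ∘ swap) q

theorem π_cls₁ (G : Network Ξ) (o : G.V) : π (G.cls₁ o) = G.cls₀ := by
  have h : mk ⟨(G.cls₁ o).G, ![(G.cls₁ o).o]⟩ = mk ⟨G, ![o]⟩ := (G.cls₁ o).cls₁_G_o
  obtain ⟨φ, -⟩ := mk_eq_mk.1 h
  exact mk_eq_mk.2 ⟨φ, fun i => i.elim0⟩

theorem cls₁_eq_of_cls₀_eq {G H : Network Ξ} (h : G.cls₀ = H.cls₀) (o : G.V) :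
    ∃ v : H.V, G.cls₁ o = H.cls₁ v := by
  obtain ⟨φ, -⟩ := mk_eq_mk.1 h
  exact ⟨φ.toV o, mk_eq_mk.2 ⟨φ, fun i => by fin_cases i; rfl⟩⟩

/-- The networks all of whose rooted versions are in `A`. -/
def allRoots (A : Set (NetClass Ξ 1)) : Set (NetClass Ξ 1) := {q | ∀ v, q.G.cls₁ v ∈ A}

theorem cls₁_mem_allRoots {A : Set (NetClass Ξ 1)} {G : Network Ξ} {o : G.V} :
    G.cls₁ o ∈ allRoots A ↔ ∀ v, G.cls₁ v ∈ A := by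
  have h : (G.cls₁ o).G.cls₀ = G.cls₀ := π_cls₁ G o
  constructor
  · intro hA v
    obtain ⟨w, hw⟩ := cls₁_eq_of_cls₀_eq h.symm v
    rw [hw]; exact hA w
  · intro hA v
    obtain ⟨w, hw⟩ := cls₁_eq_of_cls₀_eq h v
    rw [hw]; exact hA w

theorem allRoots_subset (A : Set (NetClass Ξ 1)) : allRoots A ⊆ A := by
  intro q hq
  obtain ⟨G, o, rfl⟩ := exists_cls₁ q
  exact cls₁_mem_allRoots.1 hq o

variable [MetricSpace Ξ]

theorem measurable_fst : Measurable (fst : NetClass Ξ 2 → NetClass Ξ 1) := measurable_reindex _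

theorem measurable_snd : Measurable (snd : NetClass Ξ 2 → NetClass Ξ 1) := measurable_reindex _

theorem measurable_inn {g : NetClass Ξ 2 → ℝ≥0∞} (hg : Measurable g) : Measurable (inn g) :=
  measurable_vsum hg

theorem measurable_out {g : NetClass Ξ 2 → ℝ≥0∞} (hg : Measurable g) : Measurable (out g) :=
  measurable_vsum (hg.comp (measurable_reindex _))

theorem invariant_le : invariant Ξ ≤ (inferInstance : MeasurableSpace (NetClass Ξ 1)) := fun _ h => h.1

theorem eq_of_measurable_invariant {β : Type*} [MeasurableSpace β] [MeasurableSingletonClass β]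
    {f : NetClass Ξ 1 → β} (hf : Measurable[invariant Ξ] f) (G : Network Ξ) (o v : G.V) :
    f (G.cls₁ o) = f (G.cls₁ v) :=
  ((hf (measurableSet_singleton (f (G.cls₁ o)))).2 G o v rfl).symm

/-- Quantifying over all vertices amounts to the vanishing of a sum over vertices of the indicator
of the complement, and such sums are measurable. -/
theorem measurableSet_allRoots {A : Set (NetClass Ξ 1)} (hA : MeasurableSet A) :
    MeasurableSet[invariant Ξ] (allRoots A) := by
  refine ⟨?_, fun G o v h => cls₁_mem_allRoots.2 (cls₁_mem_allRoots.1 h)⟩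
  have h : allRoots A = inn (fun y => Aᶜ.indicator 1 (fst y)) ⁻¹' {0} := by
    ext q
    obtain ⟨G, o, rfl⟩ := exists_cls₁ q
    rw [cls₁_mem_allRoots]
    simp [inn_cls₁]
  rw [h]
  exact measurable_inn ((measurable_one.indicator hA.compl).comp measurable_fst)
    (measurableSet_singleton 0)

/-- Truncation of `g` at `n` and monotone convergence. The weights `a`, `b` allow one proof for mass
transport on all vertices and on `S`. -/
theorem lintegral_out_eq_inn_of_nnreal {μ : Measure (NetClass Ξ 1)} {a b : NetClass Ξ 2 → ℝ≥0∞}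
    (ha : Measurable a) (hb : Measurable b)
    (h : ∀ g : NetClass Ξ 2 → ℝ≥0, Measurable g →
      ∫⁻ x, out (fun y => a y * g y) x ∂μ = ∫⁻ x, inn (fun y => b y * g y) x ∂μ)
    {g : NetClass Ξ 2 → ℝ≥0∞} (hg : Measurable g) :
    ∫⁻ x, out (fun y => a y * g y) x ∂μ = ∫⁻ x, inn (fun y => b y * g y) x ∂μ := by
  let f : ℕ → NetClass Ξ 2 → ℝ≥0 := fun n y => (min (g y) n).toNNReal
  have hf : ∀ n, Measurable (f n) := fun n => (hg.min measurable_const).ennreal_toNNReal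
  have hfg : ∀ n y, (f n y : ℝ≥0∞) = min (g y) n := fun n y =>
    ENNReal.coe_toNNReal (ne_top_of_le_ne_top (ENNReal.natCast_ne_top n) (min_le_right _ _))
  have hmono : ∀ c : NetClass Ξ 2 → ℝ≥0∞, Monotone fun n y => c y * (f n y : ℝ≥0∞) := by
    intro c i j hij y
    simp only [hfg]
    gcongr
  have hsup : ∀ c : NetClass Ξ 2 → ℝ≥0∞,
      (fun y => c y * g y) = fun y => ⨆ n, c y * (f n y : ℝ≥0∞) := by
    intro c
    funext y
    simp only [hfg]
    rw [← ENNReal.mul_iSup]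
    congr 1
    change g y = ⨆ n : ℕ, g y ⊓ n
    rw [← inf_iSup_eq, ENNReal.iSup_natCast, inf_top_eq]
  have hm : ∀ {c : NetClass Ξ 2 → ℝ≥0∞}, Measurable c → ∀ n,
      Measurable fun y => c y * (f n y : ℝ≥0∞) := fun hc n => hc.mul (hf n).coe_nnreal_ennreal
  rw [hsup a, hsup b]
  simp only [out_iSup (hmono a), inn_iSup (hmono b)]
  rw [lintegral_iSup (fun n => measurable_out (hm ha n)) fun i j h => out_mono (hmono a h),
    lintegral_iSup (fun n => measurable_inn (hm hb n)) fun i j h => inn_mono (hmono b h)]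
  exact iSup_congr fun n => h _ (hf n)

/-- The mass transport principle for extended nonnegative functions. -/
theorem _root_.IsUnimodular.lintegral_out_eq {ν : Measure (NetClass Ξ 1)} (hν : IsUnimodular ν)
    {g : NetClass Ξ 2 → ℝ≥0∞} (hg : Measurable g) :
    ∫⁻ x, out g x ∂ν = ∫⁻ x, inn g x ∂ν := by
  have h := lintegral_out_eq_inn_of_nnreal (μ := ν) (a := 1) (b := 1) measurable_one
    measurable_one (fun f hf => ?_) hg
  · simpa using h
  · have h := hν f hf
    simp only [outflow_eq, inflow_eq, cls₁_G_o] at h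
    simpa using h

/-- Everything shows at the root. -/
theorem _root_.IsUnimodular.ae_mem_allRoots {ν : Measure (NetClass Ξ 1)}
    (hν : IsUnimodular ν) {A : Set (NetClass Ξ 1)} (hA : MeasurableSet A) (h : ∀ᵐ x ∂ν, x ∈ A) :
    ∀ᵐ x ∂ν, x ∈ allRoots A := by
  -- Every vertex sends mass one to each vertex outside `A`. The root lies in `A`, so it receives
  -- nothing; hence on average it sends nothing, and no vertex is outside `A`.
  have hm : Measurable fun y : NetClass Ξ 2 => Aᶜ.indicator (1 : NetClass Ξ 1 → ℝ≥0∞) (snd y) :=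
    (measurable_one.indicator hA.compl).comp measurable_snd
  have h1 := hν.lintegral_out_eq hm
  have h2 : ∫⁻ x, inn (fun y => Aᶜ.indicator 1 (snd y)) x ∂ν = 0 := by
    refine lintegral_eq_zero_of_ae_eq_zero ?_
    filter_upwards [h] with x hx
    have h3 := inn_snd_mul (Aᶜ.indicator 1) (fun _ => 1) x
    simp only [mul_one] at h3
    rw [h3]
    simp [hx]
  rw [h2, lintegral_eq_zero_iff (measurable_out hm)] at h1
  filter_upwards [h1] with q hq
  obtain ⟨G, o, rfl⟩ := exists_cls₁ q
  rw [cls₁_mem_allRoots]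
  intro v
  rw [out_cls₁] at hq
  have := ENNReal.tsum_eq_zero.1 hq v
  simpa using this

/-- Independence of the root makes `A` saturated for `π`, and `J` contains every set with measurable
preimage, so `π '' A` serves as `B`. -/
theorem exists_preimage_π {A : Set (NetClass Ξ 1)} (hA : MeasurableSet[invariant Ξ] A) :
    ∃ B : Set (NetClass Ξ 0), MeasurableSet B ∧ π ⁻¹' B = A := by
  have h : π ⁻¹' (π '' A) = A := by
    refine Set.Subset.antisymm ?_ (Set.subset_preimage_image _ _)
    rintro q ⟨r, hr, h⟩
    obtain ⟨G, o, rfl⟩ := exists_cls₁ q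
    obtain ⟨H, v, rfl⟩ := exists_cls₁ r
    rw [π_cls₁, π_cls₁] at h
    obtain ⟨w, hw⟩ := cls₁_eq_of_cls₀_eq h v
    rw [hw] at hr
    exact hA.2 G w o hr
  refine ⟨π '' A, ?_, h⟩
  change MeasurableSet (π ⁻¹' (π '' A))
  rw [h]
  exact hA.1

theorem measurable_π : Measurable (π : NetClass Ξ 1 → NetClass Ξ 0) := fun _ h => h

theorem measure_eq_zero_of_map_π {ν μ : Measure (NetClass Ξ 1)} (h : ν.map π ≪ μ.map π)
    {A : Set (NetClass Ξ 1)} (hA : MeasurableSet[invariant Ξ] A) (hμ : μ A = 0) : ν A = 0 := by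
  obtain ⟨B, hB, rfl⟩ := exists_preimage_π hA
  rw [← Measure.map_apply measurable_π hB] at hμ ⊢
  exact h hμ

/-- An invariant function as a function of the non-rooted network. -/
theorem exists_comp_π {f : NetClass Ξ 1 → ℝ≥0} (hf : Measurable[invariant Ξ] f) :
    ∃ c : NetClass Ξ 0 → ℝ≥0, Measurable c ∧ ∀ (G : Network Ξ) (o : G.V),
      f (G.cls₁ o) = c G.cls₀ := by
  classical
  have key : ∀ (G : Network Ξ) (o : G.V) (h : ∃ q : NetClass Ξ 1, π q = G.cls₀),
      f h.choose = f (G.cls₁ o) := by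
    intro G o h
    obtain ⟨H, v, hv⟩ := exists_cls₁ h.choose
    have h1 := h.choose_spec
    rw [hv, π_cls₁] at h1
    obtain ⟨w, hw⟩ := cls₁_eq_of_cls₀_eq h1 v
    rw [hv, hw]
    exact eq_of_measurable_invariant hf G w o
  -- Networks are nonempty, so every class is in the range of `π` and the default `0` is never
  -- taken.
  let c : NetClass Ξ 0 → ℝ≥0 := fun r => if h : ∃ q : NetClass Ξ 1, π q = r then f h.choose else 0
  have hc : ∀ (G : Network Ξ) (o : G.V), f (G.cls₁ o) = c G.cls₀ := by
    intro G o
    have h : ∃ q : NetClass Ξ 1, π q = G.cls₀ := ⟨G.cls₁ o, π_cls₁ G o⟩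
    change _ = dite _ _ _
    rw [dif_pos h, key G o h]
  refine ⟨c, fun s hs => ?_, hc⟩
  change MeasurableSet (π ⁻¹' (c ⁻¹' s))
  have h : π ⁻¹' (c ⁻¹' s) = f ⁻¹' s := by
    ext q
    obtain ⟨G, o, rfl⟩ := exists_cls₁ q
    simp [π_cls₁, hc]
  rw [h]
  exact (hf hs).1

/-- Membership is defined through a chosen representative; covariance makes it independent of the
choice. -/
theorem _root_.CovariantSubset.cls₁_mem {S : CovariantSubset Ξ} {G : Network Ξ} {o : G.V} :
    G.cls₁ o ∈ {x : NetClass Ξ 1 | x.o ∈ S.carrier x.G} ↔ o ∈ S.carrier G := by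
  have h : mk ⟨(G.cls₁ o).G, ![(G.cls₁ o).o]⟩ = mk ⟨G, ![o]⟩ := (G.cls₁ o).cls₁_G_o
  obtain ⟨φ, hφ⟩ := mk_eq_mk.1 h
  have h0 : φ.toV (G.cls₁ o).o = o := hφ 0
  change (G.cls₁ o).o ∈ S.carrier (G.cls₁ o).G ↔ _
  rw [← S.covariant _ _ φ]
  constructor
  · intro h; exact ⟨_, h, h0⟩
  · rintro ⟨w, hw, h⟩
    have h1 : w = (G.cls₁ o).o := φ.toV.injective (h.trans h0.symm)
    rwa [← h1]

end NetClass

/-! ### Greedy transport and invariant densities -/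

namespace NetClass

variable {Ξ : Type*} [MetricSpace Ξ]

open RootedNetwork

theorem swap_mem_nearSet {y : NetClass Ξ 2} {n : ℕ} :
    swap y ∈ nearSet Ξ 1 n ↔ y ∈ nearSet Ξ 1 n := by
  have key : ∀ (G : Network Ξ) (o v : G.V), G.cls₂ o v ∈ nearSet Ξ 1 n ↔ G.graph.dist v o ≤ n := by
    intro G o v
    refine (mk_mem_nearSet (x := (⟨G, ![o, v]⟩ : RootedNetwork Ξ 2))).trans ?_
    exact ⟨fun ⟨i, hi⟩ => by fin_cases i; exact hi, fun h => ⟨0, h⟩⟩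
  obtain ⟨G, o, v, rfl⟩ := exists_cls₂ y
  rw [swap_cls₂, key, key, SimpleGraph.dist_comm]

/-- There is a strictly positive measurable function on doubly-rooted networks with total inflow
and outflow at most one. -/
theorem exists_pos_inn_le_one_out_le_one (Ξ : Type*) [MetricSpace Ξ] :
    ∃ k : NetClass Ξ 2 → ℝ≥0∞, Measurable k ∧ (∀ y, k y ≠ 0) ∧ (∀ q, inn k q ≤ 1) ∧
      ∀ q, out k q ≤ 1 := by
  let E : ℕ → NetClass Ξ 2 → ℝ≥0∞ := fun n => (nearSet Ξ 1 n).indicator 1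
  let N : ℕ → NetClass Ξ 1 → ℝ≥0∞ := fun n => inn (E n)
  have hN : ∀ n q, N n q < ∞ := fun n q => vsum_nearSet_lt_top n q
  have hNout : ∀ n, out (E n) = N n := by
    intro n
    refine congrArg vsum (funext fun y => ?_)
    by_cases hy : y ∈ nearSet Ξ 1 n
    · have h1 : E n y = 1 := Set.indicator_of_mem hy _
      exact (Set.indicator_of_mem (swap_mem_nearSet.2 hy) _).trans h1.symm
    · have h1 : E n y = 0 := Set.indicator_of_notMem hy _
      exact (Set.indicator_of_notMem (mt swap_mem_nearSet.1 hy) _).trans h1.symm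
  have hE : ∀ n, Measurable (E n) := fun n =>
    measurable_one.indicator (isOpen_nearSet n).measurableSet
  have hNm : ∀ n, Measurable (N n) := fun n => measurable_inn (hE n)
  let a : ℕ → ℝ≥0∞ := fun n => 2⁻¹ ^ (n + 1)
  have ha : ∑' n, a n = 1 := by
    rw [ENNReal.tsum_geometric_add_one, ENNReal.one_sub_inv_two, inv_inv]
    exact ENNReal.inv_mul_cancel two_ne_zero ENNReal.ofNat_ne_top
  let f : ℕ → NetClass Ξ 1 → ℝ≥0∞ := fun n q => a n * (1 + N n q)⁻¹
  have hf : ∀ n q, f n q * N n q ≤ a n := by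
    intro n q
    rw [mul_assoc]
    refine mul_le_of_le_one_right' ?_
    rw [mul_comm, ← div_eq_mul_inv]
    exact ENNReal.div_le_of_le_mul (by rw [one_mul]; exact le_add_self)
  -- At scale `n`, pairs at distance at most `n` get weight `a n` divided by more than the ball
  -- counts of both ends. This bounds inflow and outflow by `a n`, and `∑ a n = 1`. Every pair is
  -- reached at some scale, whence positivity.
  let k : NetClass Ξ 2 → ℝ≥0∞ := fun y =>
    ∑' n, E n y * (a n * (1 + (N n (fst y) + N n (snd y)))⁻¹)
  have hk1 : ∀ y, k y ≤ ∑' n, f n (fst y) * E n y := by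
    intro y
    refine ENNReal.tsum_le_tsum fun n => ?_
    rw [mul_comm]
    exact mul_le_mul_left (mul_le_mul_right (ENNReal.inv_le_inv.2 (add_le_add_right le_self_add 1)) _) _
  have hk2 : ∀ y, k y ≤ ∑' n, f n (snd y) * E n y := by
    intro y
    refine ENNReal.tsum_le_tsum fun n => ?_
    rw [mul_comm]
    exact mul_le_mul_left (mul_le_mul_right (ENNReal.inv_le_inv.2 (add_le_add_right le_add_self 1)) _) _
  refine ⟨k, ?_, ?_, ?_, ?_⟩
  · refine Measurable.tsum fun n => (hE n).mul (measurable_const.mul ?_)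
    exact (measurable_const.add (((hNm n).comp measurable_fst).add
      ((hNm n).comp measurable_snd))).inv
  · intro y hy
    obtain ⟨x, rfl⟩ := mk_surjective y
    obtain ⟨n, hn⟩ := exists_mem_ball (x.reindex Fin.succ) (x.root 0)
    have h := ENNReal.tsum_eq_zero.1 hy n
    have h1 : E n (mk x) = 1 := Set.indicator_of_mem (mk_mem_nearSet.2 hn) _
    rw [h1, one_mul, mul_eq_zero] at h
    rcases h with h | h
    · simp [a] at h
    · rw [ENNReal.inv_eq_zero] at h
      simp [(hN _ _).ne] at h
  · intro q
    calc inn k q ≤ inn (fun y => ∑' n, f n (snd y) * E n y) q := inn_mono hk2 q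
      _ = ∑' n, f n q * N n q := by
        rw [inn_tsum]
        exact tsum_congr fun n => inn_snd_mul (f n) (E n) q
      _ ≤ ∑' n, a n := ENNReal.tsum_le_tsum fun n => hf n q
      _ = 1 := ha
  · intro q
    calc out k q ≤ out (fun y => ∑' n, f n (fst y) * E n y) q := out_mono hk1 q
      _ = ∑' n, f n q * N n q := by
        rw [out_tsum]
        exact tsum_congr fun n => by rw [out_fst_mul (f n) (E n) q, hNout]
      _ ≤ ∑' n, a n := ENNReal.tsum_le_tsum fun n => hf n q
      _ = 1 := ha

/-- A greedy transport from the counting measure to the measure with weights `ψ`: either all the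
mass is sent, or all the demand is satisfied. -/
theorem exists_greedy_transport {ψ : NetClass Ξ 1 → ℝ≥0∞} (hψ : Measurable ψ)
    (hψtop : ∀ q, ψ q ≠ ∞) :
    ∃ T : NetClass Ξ 2 → ℝ≥0∞, Measurable T ∧ (∀ q, out T q ≤ 1) ∧ (∀ q, inn T q ≤ ψ q) ∧
      ∀ (G : Network Ξ) (u v : G.V),
        out T (G.cls₁ u) = 1 ∨ inn T (G.cls₁ v) = ψ (G.cls₁ v) := by
  obtain ⟨k, hk, hk0, hkin, hkout⟩ := exists_pos_inn_le_one_out_le_one Ξ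
  -- One round ships remaining supply times remaining demand times a small weight. The factor `(1 +
  -- ψ)⁻¹` makes the relative demand at most one, so that no round exceeds the remaining supply.
  let F : (NetClass Ξ 1 → ℝ≥0∞) × (NetClass Ξ 1 → ℝ≥0∞) → NetClass Ξ 2 → ℝ≥0∞ := fun p y =>
    p.1 (fst y) * (p.2 (snd y) * ((1 + ψ (snd y))⁻¹ * k y))
  -- The pair is (remaining supply, remaining demand), starting from `(1, ψ)`.
  let s : ℕ → (NetClass Ξ 1 → ℝ≥0∞) × (NetClass Ξ 1 → ℝ≥0∞) := fun n =>
    Nat.rec (1, ψ) (fun _ p => (fun q => p.1 q - out (F p) q, fun q => p.2 q - inn (F p) q)) n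
  let φn : ℕ → NetClass Ξ 1 → ℝ≥0∞ := fun n => (s n).1
  let ψn : ℕ → NetClass Ξ 1 → ℝ≥0∞ := fun n => (s n).2
  let T : ℕ → NetClass Ξ 2 → ℝ≥0∞ := fun n => F (s n)
  have hφ_succ : ∀ n q, φn (n + 1) q = φn n q - out (T n) q := fun _ _ => rfl
  have hψ_succ : ∀ n q, ψn (n + 1) q = ψn n q - inn (T n) q := fun _ _ => rfl
  have hφ1 : ∀ n q, φn n q ≤ 1 := by
    intro n
    induction n with
    | zero => exact fun q => le_rfl
    | succ n ih => exact fun q => (hφ_succ n q).le.trans (tsub_le_self.trans (ih q))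
  have hψ1 : ∀ n q, ψn n q ≤ ψ q := by
    intro n
    induction n with
    | zero => exact fun q => le_rfl
    | succ n ih => exact fun q => (hψ_succ n q).le.trans (tsub_le_self.trans (ih q))
  have hFm : ∀ p : (NetClass Ξ 1 → ℝ≥0∞) × (NetClass Ξ 1 → ℝ≥0∞),
      Measurable p.1 → Measurable p.2 → Measurable (F p) := fun p h1 h2 =>
    (h1.comp measurable_fst).mul ((h2.comp measurable_snd).mul
      (((measurable_const.add (hψ.comp measurable_snd)).inv).mul hk))
  have hsm : ∀ n, Measurable (φn n) ∧ Measurable (ψn n) := by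
    intro n
    induction n with
    | zero => exact ⟨measurable_one, hψ⟩
    | succ n ih =>
      have := hFm (s n) ih.1 ih.2
      exact ⟨ih.1.sub (measurable_out this), ih.2.sub (measurable_inn this)⟩
  have hTm : ∀ n, Measurable (T n) := fun n => hFm (s n) (hsm n).1 (hsm n).2
  have hinv : ∀ n q, ψn n q * (1 + ψ q)⁻¹ ≤ 1 := by
    intro n q
    rw [← div_eq_mul_inv]
    exact ENNReal.div_le_of_le_mul (by rw [one_mul]; exact (hψ1 n q).trans le_add_self)
  have hout : ∀ n q, out (T n) q ≤ φn n q := by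
    intro n q
    calc out (T n) q = φn n q * out (fun y => ψn n (snd y) * ((1 + ψ (snd y))⁻¹ * k y)) q :=
          out_fst_mul _ _ _
      _ ≤ φn n q * out k q := by
        gcongr
        refine out_mono (fun y => ?_) q
        rw [← mul_assoc]
        exact mul_le_of_le_one_left' (hinv n _)
      _ ≤ φn n q := mul_le_of_le_one_right' (hkout q)
  have hinn : ∀ n q, inn (T n) q ≤ ψn n q := by
    intro n q
    calc inn (T n) q = inn (fun y => ψn n (snd y) * (φn n (fst y) * ((1 + ψ (snd y))⁻¹ * k y))) q :=
          congrArg (fun f => inn f q) (funext fun y => mul_left_comm _ _ _)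
      _ = ψn n q * inn (fun y => φn n (fst y) * ((1 + ψ (snd y))⁻¹ * k y)) q := inn_snd_mul _ _ _
      _ ≤ ψn n q * inn k q := by
        gcongr
        refine inn_mono (fun y => ?_) q
        refine (mul_le_of_le_one_left' (hφ1 n _)).trans (mul_le_of_le_one_left' ?_)
        exact ENNReal.inv_le_one.2 le_self_add
      _ ≤ ψn n q := mul_le_of_le_one_right' (hkin q)
  -- No round overdraws, so the truncated subtractions are exact and mass is conserved.
  have hsumφ : ∀ n q, φn n q + ∑ i ∈ Finset.range n, out (T i) q = 1 := by
    intro n q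
    induction n with
    | zero => rw [Finset.sum_range_zero, add_zero]; rfl
    | succ n ih =>
      rw [Finset.sum_range_succ, hφ_succ, add_comm (∑ i ∈ _, _), ← add_assoc,
        tsub_add_cancel_of_le (hout n q), ih]
  have hsumψ : ∀ n q, ψn n q + ∑ i ∈ Finset.range n, inn (T i) q = ψ q := by
    intro n q
    induction n with
    | zero => rw [Finset.sum_range_zero, add_zero]; rfl
    | succ n ih =>
      rw [Finset.sum_range_succ, hψ_succ, add_comm (∑ i ∈ _, _), ← add_assoc,
        tsub_add_cancel_of_le (hinn n q), ih]
  let T' : NetClass Ξ 2 → ℝ≥0∞ := fun y => ∑' n, T n y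
  have hT'out : ∀ q, out T' q = ∑' n, out (T n) q := fun q => out_tsum T q
  have hT'inn : ∀ q, inn T' q = ∑' n, inn (T n) q := fun q => inn_tsum T q
  have hout1 : ∀ q, out T' q ≤ 1 := by
    intro q
    rw [hT'out]
    exact ENNReal.tsum_le_of_sum_range_le fun n => le_add_self.trans (hsumφ n q).le
  have hinn1 : ∀ q, inn T' q ≤ ψ q := by
    intro q
    rw [hT'inn]
    exact ENNReal.tsum_le_of_sum_range_le fun n => le_add_self.trans (hsumψ n q).le
  refine ⟨T', Measurable.tsum hTm, hout1, hinn1, ?_⟩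
  intro G u v
  -- Supply left at `u` and demand left at `v` bound the remainders of every round from below. Each
  -- round then ships at least a fixed positive amount from `u` to `v`, an infinite total, although
  -- the outflow is at most one.
  by_contra! hne
  have ha : 1 - out T' (G.cls₁ u) ≠ 0 := by
    rw [ne_eq, tsub_eq_zero_iff_le, not_le]
    exact lt_of_le_of_ne (hout1 _) hne.1
  have hb : ψ (G.cls₁ v) - inn T' (G.cls₁ v) ≠ 0 := by
    rw [ne_eq, tsub_eq_zero_iff_le, not_le]
    exact lt_of_le_of_ne (hinn1 _) hne.2
  have ha' : ∀ n, 1 - out T' (G.cls₁ u) ≤ φn n (G.cls₁ u) := by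
    intro n
    rw [tsub_le_iff_right, ← hsumφ n (G.cls₁ u), hT'out]
    gcongr
    exact ENNReal.sum_le_tsum _
  have hb' : ∀ n, ψ (G.cls₁ v) - inn T' (G.cls₁ v) ≤ ψn n (G.cls₁ v) := by
    intro n
    rw [tsub_le_iff_right, ← hsumψ n (G.cls₁ v), hT'inn]
    gcongr
    exact ENNReal.sum_le_tsum _
  have h1 : T' (G.cls₂ u v) ≤ 1 := by
    refine le_trans ?_ (hout1 (G.cls₁ u))
    rw [out_cls₁]
    exact ENNReal.le_tsum (f := fun v => T' (G.cls₂ u v)) v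
  have h2 : T' (G.cls₂ u v) = ∞ := by
    refine top_le_iff.1 ?_
    have hc : (1 - out T' (G.cls₁ u)) * ((ψ (G.cls₁ v) - inn T' (G.cls₁ v)) *
        ((1 + ψ (G.cls₁ v))⁻¹ * k (G.cls₂ u v))) ≠ 0 := by
      refine mul_ne_zero ha (mul_ne_zero hb (mul_ne_zero ?_ (hk0 _)))
      exact ENNReal.inv_ne_zero.2 (ENNReal.add_ne_top.2 ⟨ENNReal.one_ne_top, hψtop _⟩)
    rw [← ENNReal.tsum_const_eq_top_of_ne_zero (α := ℕ) hc]
    refine ENNReal.tsum_le_tsum fun n => ?_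
    change _ ≤ φn n (fst (G.cls₂ u v)) * (ψn n (snd (G.cls₂ u v)) * ((1 + ψ (snd (G.cls₂ u v)))⁻¹ *
      k (G.cls₂ u v)))
    rw [fst_cls₂, snd_cls₂]
    gcongr
    · exact ha' n
    · exact hb' n
  rw [h2] at h1
  simp at h1

/-- If a measurable set is almost surely visited, then its indicator function times a suitable
invariant function has conditional expectation one. -/
theorem exists_invariant_density {ν : Measure (NetClass Ξ 1)} [IsFiniteMeasure ν]
    (hν : IsUnimodular ν) {A : Set (NetClass Ξ 1)} (hA : MeasurableSet A)
    (hne : ∀ᵐ x ∂ν, x ∉ allRoots Aᶜ) :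
    ∃ c : NetClass Ξ 1 → ℝ≥0, Measurable[invariant Ξ] c ∧
      ∀ B, MeasurableSet[invariant Ξ] B →
        ∫⁻ x in B, A.indicator (fun x => (c x : ℝ≥0∞)) x ∂ν = ν B := by
  -- On the invariant sigma-field, `ρ` is `τ` weighted by the conditional probability of `A`; the
  -- density of `τ` with respect to `ρ` is its reciprocal.
  let τ := ν.trim invariant_le
  let ρ := (ν.restrict A).trim invariant_le
  have hac : τ ≪ ρ := by
    refine Measure.AbsolutelyContinuous.mk fun B hB h => ?_
    rw [trim_measurableSet_eq _ hB] at h ⊢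
    rw [Measure.restrict_apply hB.1] at h
    have h1 : ∀ᵐ x ∂ν, x ∈ (B ∩ A)ᶜ := measure_eq_zero_iff_ae_notMem.1 h
    refine measure_eq_zero_iff_ae_notMem.2 ?_
    -- If an invariant `B` meets `A` in a null set, then almost surely no vertex of a network in `B`
    -- shows `A`, which `hne` excludes.
    filter_upwards [hν.ae_mem_allRoots (hB.1.inter hA).compl h1, hne] with x hx hx' hxB
    refine hx' ?_
    obtain ⟨G, o, rfl⟩ := exists_cls₁ x
    rw [cls₁_mem_allRoots] at hx ⊢
    exact fun v hv => hx v ⟨hB.2 G o v hxB, hv⟩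
  let d := τ.rnDeriv ρ
  have hd : Measurable[invariant Ξ] d := Measure.measurable_rnDeriv _ _
  have hdtop : ∀ᵐ x ∂ρ, d x < ∞ := Measure.rnDeriv_lt_top _ _
  refine ⟨fun x => (d x).toNNReal, hd.ennreal_toNNReal, fun B hB => ?_⟩
  calc ∫⁻ x in B, A.indicator (fun x => ((d x).toNNReal : ℝ≥0∞)) x ∂ν
      = ∫⁻ x in A, B.indicator (fun x => ((d x).toNNReal : ℝ≥0∞)) x ∂ν := by
        rw [← lintegral_indicator hB.1, ← lintegral_indicator hA]
        congr 1
        funext x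
        by_cases h1 : x ∈ A <;> by_cases h2 : x ∈ B <;> simp [h1, h2]
    _ = ∫⁻ x, B.indicator (fun x => ((d x).toNNReal : ℝ≥0∞)) x ∂ρ :=
        (lintegral_trim invariant_le
          ((hd.ennreal_toNNReal.coe_nnreal_ennreal).indicator hB)).symm
    _ = ∫⁻ x, B.indicator d x ∂ρ := by
        refine lintegral_congr_ae ?_
        filter_upwards [hdtop] with x hx
        by_cases h2 : x ∈ B <;> simp [h2, hx.ne]
    _ = τ B := by
        rw [lintegral_indicator hB, ← withDensity_apply _ hB, Measure.withDensity_rnDeriv_eq _ _ hac]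
    _ = ν B := trim_measurableSet_eq _ hB

end NetClass

/-! ### Construction of the transport kernel -/

namespace NetClass

variable {Ξ : Type*}

theorem tsum_mul_indicator_eq_inn (T : NetClass Ξ 2 → ℝ≥0) (f : NetClass Ξ 1 → ℝ≥0∞)
    (x : NetClass Ξ 1) :
    ∑' v : x.G.V, (T (x.G.cls₂ v x.o) : ℝ≥0∞) * f (x.G.cls₁ v) =
      inn (fun y => T y * f (fst y)) x := by
  conv_rhs => rw [← x.cls₁_G_o]
  simp only [inn_cls₁, fst_cls₂]

theorem inflow_G_o (T : NetClass Ξ 2 → ℝ≥0) (x : NetClass Ξ 1) :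
    inflow T x.G x.o = inn (fun y => (T y : ℝ≥0∞)) x := by
  rw [inflow_eq, cls₁_G_o]

theorem outflow_G_o (T : NetClass Ξ 2 → ℝ≥0) (x : NetClass Ξ 1) :
    outflow T x.G x.o = out (fun y => (T y : ℝ≥0∞)) x := by
  rw [outflow_eq, cls₁_G_o]

variable [MetricSpace Ξ]

/-- The set of rooted networks whose root is in the covariant subset. -/
def rootIn (S : CovariantSubset Ξ) : Set (NetClass Ξ 1) := {x | x.o ∈ S.carrier x.G}

theorem cls₁_mem_rootIn {S : CovariantSubset Ξ} {G : Network Ξ} {o : G.V} :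
    G.cls₁ o ∈ rootIn S ↔ o ∈ S.carrier G := CovariantSubset.cls₁_mem

theorem measurableSet_rootIn (S : CovariantSubset Ξ) : MeasurableSet (rootIn S) := S.measurable

/-- In a unimodular network there is an invariant transport from the counting measure on the
vertices to a multiple of the counting measure on a covariant subset. -/
theorem exists_balanced_transport {ν : Measure (NetClass Ξ 1)} [IsProbabilityMeasure ν]
    (hν : IsUnimodular ν) {A : Set (NetClass Ξ 1)} (hA : MeasurableSet A)
    (hne : ∀ᵐ x ∂ν, x ∉ allRoots Aᶜ) :
    ∃ (T : NetClass Ξ 2 → ℝ≥0) (c : NetClass Ξ 1 → ℝ≥0), Measurable T ∧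
      Measurable[invariant Ξ] c ∧ (∀ᵐ x ∂ν, c x ≠ 0) ∧
      (∀ᵐ x ∂ν, x ∈ allRoots {x | out (fun y => (T y : ℝ≥0∞)) x = 1}) ∧
      ∀ᵐ x ∂ν, x ∈ allRoots {x | inn (fun y => (T y : ℝ≥0∞)) x =
        A.indicator (fun x => (c x : ℝ≥0∞)) x} := by
  obtain ⟨c, hc, hcB⟩ := exists_invariant_density hν hA hne
  have hcm : Measurable c := hc.mono invariant_le le_rfl
  set ψ : NetClass Ξ 1 → ℝ≥0∞ := A.indicator fun x => (c x : ℝ≥0∞)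
  have hψ : Measurable ψ := hcm.coe_nnreal_ennreal.indicator hA
  have hψtop : ∀ q, ψ q ≠ ∞ := fun q =>
    ne_top_of_le_ne_top ENNReal.coe_ne_top (Set.indicator_le_self' (fun _ _ => zero_le) q)
  obtain ⟨T, hT, hTout, hTinn, hTor⟩ := exists_greedy_transport hψ hψtop
  have hTtop : ∀ y, T y ≠ ∞ := by
    intro y
    obtain ⟨G, u, v, rfl⟩ := exists_cls₂ y
    refine ne_top_of_le_ne_top ENNReal.one_ne_top (le_trans ?_ (hTout (G.cls₁ u)))
    rw [out_cls₁]
    exact ENNReal.le_tsum (f := fun v => T (G.cls₂ u v)) v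
  have hTcoe : (fun y => ((T y).toNNReal : ℝ≥0∞)) = T :=
    funext fun y => ENNReal.coe_toNNReal (hTtop y)
  have hTo := measurable_out hT
  have hTi := measurable_inn hT
  -- Both roots of a doubly-rooted network lie in an invariant `D` together, so mass transport
  -- localizes to `D`.
  have hmtp : ∀ D, MeasurableSet[invariant Ξ] D → ∫⁻ x in D, out T x ∂ν = ∫⁻ x in D, inn T x ∂ν := by
    intro D hD
    have h1 : (fun y => D.indicator (1 : NetClass Ξ 1 → ℝ≥0∞) (fst y) * T y) =
        fun y => D.indicator 1 (snd y) * T y := by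
      funext y
      obtain ⟨G, u, v, rfl⟩ := exists_cls₂ y
      have h2 : G.cls₁ u ∈ D ↔ G.cls₁ v ∈ D := ⟨hD.2 G u v, hD.2 G v u⟩
      by_cases hv : G.cls₁ v ∈ D
      · simp [hv, h2.2 hv]
      · simp [hv, mt h2.1 hv]
    have hm : Measurable fun y => D.indicator (1 : NetClass Ξ 1 → ℝ≥0∞) (fst y) * T y :=
      ((measurable_one.indicator hD.1).comp measurable_fst).mul hT
    have h := hν.lintegral_out_eq hm
    rw [lintegral_congr fun x => out_fst_mul (D.indicator 1) T x, h1,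
      lintegral_congr fun x => inn_snd_mul (D.indicator 1) T x] at h
    rw [← lintegral_indicator hD.1, ← lintegral_indicator hD.1]
    convert h using 3 with x x
    · by_cases hx : x ∈ D <;> simp [hx]
    · by_cases hx : x ∈ D <;> simp [hx]
  set B := allRoots {x | out T x = 1}
  have hB : MeasurableSet[invariant Ξ] B := measurableSet_allRoots (hTo (measurableSet_singleton 1))
  have hBc : MeasurableSet[invariant Ξ] Bᶜ := hB.compl
  -- Off `B` some vertex keeps supply, so all demand is met there. The outflow, at most one, then
  -- has integral equal to that of `ψ` over `Bᶜ`, which is `ν Bᶜ`; so it equals one almost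
  -- everywhere.
  have hout : ∀ᵐ x ∂ν, out T x = 1 := by
    have h1 : ∀ᵐ x ∂ν.restrict Bᶜ, out T x = 1 := by
      refine ae_eq_of_ae_le_of_lintegral_le (Filter.Eventually.of_forall hTout) ?_
        aemeasurable_const ?_
      · refine ne_top_of_le_ne_top (measure_ne_top (ν.restrict Bᶜ) Set.univ) ?_
        calc ∫⁻ x, out T x ∂ν.restrict Bᶜ ≤ ∫⁻ _, 1 ∂ν.restrict Bᶜ := lintegral_mono hTout
          _ = _ := by simp
      · rw [hmtp _ hBc, lintegral_one, Measure.restrict_apply_univ, ← hcB _ hBc]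
        refine le_of_eq (setLIntegral_congr_fun hBc.1 fun x hx => ?_)
        obtain ⟨G, o, rfl⟩ := exists_cls₁ x
        rw [Set.mem_compl_iff, cls₁_mem_allRoots] at hx
        push Not at hx
        obtain ⟨u, hu⟩ := hx
        exact ((hTor G u o).resolve_left hu).symm
    rw [ae_restrict_iff' hBc.1] at h1
    filter_upwards [h1] with x hx
    by_cases hxB : x ∈ B
    · exact allRoots_subset _ hxB
    · exact hx hxB
  have hinn : ∀ᵐ x ∂ν, inn T x = ψ x := by
    have h1 : ∫⁻ x, inn T x ∂ν = 1 := by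
      rw [← hν.lintegral_out_eq hT, lintegral_congr_ae hout]; simp
    have h2 : ∫⁻ x, ψ x ∂ν = 1 := by
      have := hcB Set.univ MeasurableSet.univ
      simpa using this
    exact ae_eq_of_ae_le_of_lintegral_le (Filter.Eventually.of_forall hTinn)
      (by rw [h1]; exact ENNReal.one_ne_top) hψ.aemeasurable (by rw [h1, h2])
  refine ⟨fun y => (T y).toNNReal, c, hT.ennreal_toNNReal, hc, ?_, ?_, ?_⟩
  -- By `hcB` the measure of the invariant set `{c = 0}` is the integral of `ψ` over it, which
  -- vanishes.
  · have hZ : MeasurableSet[invariant Ξ] (c ⁻¹' {0}) := hc (measurableSet_singleton 0)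
    have h1 : ν (c ⁻¹' {0}) = 0 := by
      rw [← hcB _ hZ]
      refine (setLIntegral_congr_fun (g := fun _ => 0) hZ.1 fun x hx => ?_).trans (by simp)
      have : c x = 0 := hx
      simp [ψ, this]
    exact measure_eq_zero_iff_ae_notMem.1 h1
  · rw [hTcoe]
    exact hν.ae_mem_allRoots (hTo (measurableSet_singleton 1)) hout
  · rw [hTcoe]
    exact hν.ae_mem_allRoots (measurableSet_eq_fun hTi hψ) hinn

/-- The two laws on `𝒢` have the same null sets, and invariant sets are preimages from `𝒢`. This is
the only passage between `ν` and `μ` in the construction of `T`. -/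
theorem _root_.IsUnimodularization.ae_mem_iff {ν μ : Measure (NetClass Ξ 1)}
    (h : IsUnimodularization ν μ) {D : Set (NetClass Ξ 1)} (hD : MeasurableSet[invariant Ξ] D) :
    (∀ᵐ x ∂ν, x ∈ D) ↔ ∀ᵐ x ∂μ, x ∈ D := by
  have hD' : MeasurableSet[invariant Ξ] Dᶜ := hD.compl
  exact ⟨fun h1 => measure_eq_zero_of_map_π h.absolutelyContinuous' hD' h1,
    fun h1 => measure_eq_zero_of_map_π h.absolutelyContinuous hD' h1⟩

theorem measurable_mul_inn {T : NetClass Ξ 2 → ℝ≥0} (hT : Measurable T)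
    {e f : NetClass Ξ 1 → ℝ≥0∞} (he : Measurable e) (hf : Measurable f) :
    Measurable fun x => e x * inn (fun y => T y * f (fst y)) x :=
  he.mul (measurable_inn (hT.coe_nnreal_ennreal.mul (hf.comp measurable_fst)))

/-- The measure obtained by moving the root along the transport `T`, with density `e`. -/
theorem exists_transport_measure (μ : Measure (NetClass Ξ 1)) {T : NetClass Ξ 2 → ℝ≥0}
    (hT : Measurable T) {e : NetClass Ξ 1 → ℝ≥0∞} (he : Measurable e) :
    ∃ P : Measure (NetClass Ξ 1), ∀ A, MeasurableSet A →
      P A = ∫⁻ x, e x * inn (fun y => T y * A.indicator 1 (fst y)) x ∂μ := by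
  refine ⟨Measure.ofMeasurable
    (fun A _ => ∫⁻ x, e x * inn (fun y => T y * A.indicator 1 (fst y)) x ∂μ) ?_ ?_,
    fun A hA => Measure.ofMeasurable_apply A hA⟩
  · have h : ∀ x : NetClass Ξ 1, inn (fun _ => 0) x = 0 := fun x => by
      obtain ⟨G, o, rfl⟩ := exists_cls₁ x
      simp [inn_cls₁]
    simp [h]
  · intro f hf hd
    rw [← lintegral_tsum fun i => (measurable_mul_inn hT he
      (measurable_one.indicator (hf i))).aemeasurable]
    refine lintegral_congr fun x => ?_
    rw [ENNReal.tsum_mul_left, ← inn_tsum]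
    congr 2
    funext y
    rw [ENNReal.tsum_mul_left]
    congr 1
    by_cases hy : ∃ i, fst y ∈ f i
    · obtain ⟨i, hi⟩ := hy
      rw [Set.indicator_of_mem (Set.mem_iUnion.2 ⟨i, hi⟩), tsum_eq_single i,
        Set.indicator_of_mem hi]
      exact fun j hj => Set.indicator_of_notMem (fun h => Set.disjoint_left.1 (hd hj) h hi) _
    · rw [Set.indicator_of_notMem (by simpa using hy)]
      simp only [not_exists] at hy
      simp [hy]

theorem lintegral_transport_measure {μ P : Measure (NetClass Ξ 1)} {T : NetClass Ξ 2 → ℝ≥0}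
    (hT : Measurable T) {e : NetClass Ξ 1 → ℝ≥0∞} (he : Measurable e)
    (hP : ∀ A, MeasurableSet A →
      P A = ∫⁻ x, e x * inn (fun y => T y * A.indicator 1 (fst y)) x ∂μ)
    {f : NetClass Ξ 1 → ℝ≥0∞} (hf : Measurable f) :
    ∫⁻ x, f x ∂P = ∫⁻ x, e x * inn (fun y => T y * f (fst y)) x ∂μ := by
  refine Measurable.ennreal_induction (motive := fun f =>
    ∫⁻ x, f x ∂P = ∫⁻ x, e x * inn (fun y => T y * f (fst y)) x ∂μ) ?_ ?_ ?_ hf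
  · intro c A hA
    rw [lintegral_indicator_const hA, hP A hA, ← lintegral_const_mul _
      (measurable_mul_inn hT he (measurable_one.indicator hA))]
    refine lintegral_congr fun x => ?_
    rw [mul_left_comm]
    congr 1
    rw [← inn_snd_mul (fun _ => c)]
    congr 1
    funext y
    by_cases hy : fst y ∈ A <;> simp [hy, mul_comm]
  · intro f g _ hf hg ihf ihg
    simp only [Pi.add_apply, mul_add]
    rw [lintegral_add_left hf, ihf, ihg,
      ← lintegral_add_left (measurable_mul_inn hT he hf)]
    refine lintegral_congr fun x => ?_
    rw [← mul_add]
    congr 1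
    exact (congrFun (vsum_add _ _) x).symm
  · intro f hf hmono ih
    have hm : Monotone fun n (y : NetClass Ξ 2) => (T y : ℝ≥0∞) * f n (fst y) := by
      intro i j hij y
      exact mul_le_mul_right (hmono hij _) _
    rw [lintegral_iSup hf hmono]
    simp only [ENNReal.mul_iSup, inn_iSup hm]
    rw [lintegral_iSup (fun n => measurable_mul_inn hT he (hf n))
      fun i j hij x => mul_le_mul_right (inn_mono (hm hij) x) _]
    exact iSup_congr ih

/-- Existence of an admissible transport with constant inflow on the subset. -/
theorem exists_markovianKernel {ν μ : Measure (NetClass Ξ 1)} [IsProbabilityMeasure μ]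
    {S : CovariantSubset Ξ} (hroot : ∀ᵐ x ∂μ, x.o ∈ S.carrier x.G)
    (hν : IsUnimodularization ν μ) :
    ∃ T : NetClass Ξ 2 → ℝ≥0, IsMarkovianKernel μ S T ∧ (∃ P, IsPT' μ T P) ∧
      ∃ c : NetClass Ξ 0 → ℝ≥0, Measurable c ∧
        ∀ᵐ (x : NetClass Ξ 1) ∂μ, ∀ v : x.G.V, v ∈ S.carrier x.G →
          inflow T x.G v = c x.G.cls₀ := by
  have := hν.isProbabilityMeasure
  have hS := measurableSet_rootIn S
  have hne : ∀ᵐ x ∂ν, x ∉ allRoots (rootIn S)ᶜ := by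
    refine (hν.ae_mem_iff (measurableSet_allRoots hS.compl).compl).2 ?_
    filter_upwards [hroot] with x hx h
    exact allRoots_subset _ h hx
  obtain ⟨T, c, hT, hc, hc0, hout, hinn⟩ := exists_balanced_transport hν.isUnimodular hS hne
  have hTm := hT.coe_nnreal_ennreal
  have hcm : Measurable c := hc.mono invariant_le le_rfl
  replace hc0 : ∀ᵐ x ∂μ, c x ≠ 0 :=
    (hν.ae_mem_iff (D := {x | c x ≠ 0}) (hc (measurableSet_singleton 0).compl)).1 hc0
  replace hout := (hν.ae_mem_iff (measurableSet_allRoots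
    (measurable_out hTm (measurableSet_singleton 1)))).1 hout
  replace hinn := (hν.ae_mem_iff (measurableSet_allRoots (measurableSet_eq_fun
    (measurable_inn hTm) (hcm.coe_nnreal_ennreal.indicator hS)))).1 hinn
  have hinn' : ∀ᵐ x ∂μ, inflow T x.G x.o = c x := by
    filter_upwards [hinn, hroot] with x hx hx'
    have h : inn (fun y => (T y : ℝ≥0∞)) x = _ := allRoots_subset _ hx
    rw [inflow_G_o, h, Set.indicator_of_mem]
    exact hx'
  -- The root lies in `S`, where the inflow is the invariant function `c`, so conditioning on the
  -- invariant sigma-field changes nothing.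
  have hcond : condMass μ T =ᵐ[μ] fun x => (c x : ℝ≥0∞) := by
    have h1 := condLExp_congr_ae (mΩ := invariant Ξ) hinn'
    rw [condLExp_eq_self invariant_le μ (X := fun x => (c x : ℝ≥0∞)) hc.coe_nnreal_ennreal] at h1
    exact h1
  have hcondm : Measurable (condMass μ T) := measurable_condLExp' _ _ _
  refine ⟨T, ⟨hT, ?_⟩, ?_, ?_⟩
  · filter_upwards [hout, hinn] with x hx hx' v
    refine ⟨(outflow_eq T x.G v).trans (hx v), fun z hz => ?_⟩
    have h : inn (fun y => (T y : ℝ≥0∞)) (x.G.cls₁ z) = _ := hx' z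
    rw [Set.indicator_of_notMem (fun h => hz (cls₁_mem_rootIn.1 h)), inn_cls₁] at h
    exact_mod_cast ENNReal.tsum_eq_zero.1 h v
  · obtain ⟨P, hP⟩ := exists_transport_measure μ hT hcondm.inv
    refine ⟨P, ?_, ?_, ⟨?_⟩, fun A hA => ?_⟩
    · filter_upwards [hcond, hc0] with x hx hx'
      rw [hx]
      exact ENNReal.coe_pos.2 (pos_iff_ne_zero.2 hx')
    · filter_upwards [hcond] with x hx
      rw [hx]
      exact ENNReal.coe_lt_top
    · rw [hP _ MeasurableSet.univ]
      refine (lintegral_congr_ae (g := fun _ => 1) ?_).trans (by simp)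
      filter_upwards [hcond, hc0, hinn'] with x hx hx' hx''
      rw [inflow_G_o] at hx''
      simp only [Set.indicator_univ, Pi.one_apply, mul_one, Pi.inv_apply, hx, hx'']
      exact ENNReal.inv_mul_cancel (ENNReal.coe_ne_zero.2 hx') ENNReal.coe_ne_top
    · rw [hP A hA]
      exact lintegral_congr fun x => by rw [tsum_mul_indicator_eq_inn]; rfl
  · obtain ⟨c', hc'm, hc'⟩ := exists_comp_π hc
    refine ⟨c', hc'm, ?_⟩
    filter_upwards [hinn] with x hx v hv
    have h : inn (fun y => (T y : ℝ≥0∞)) (x.G.cls₁ v) = _ := hx v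
    rw [inflow_eq, h, Set.indicator_of_mem (cls₁_mem_rootIn.2 hv), hc']

end NetClass

/-! ### Unimodularity of `P'_T` and invariant biasing -/

namespace NetClass

variable {Ξ : Type*}

/-- The composition of two transports. -/
noncomputable def comp (a b : NetClass Ξ 2 → ℝ≥0∞) : NetClass Ξ 2 → ℝ≥0∞ :=
  -- For roots `(v, o, s)` with summed vertex `v` in front, `![1, 0]` selects `(o, v)` and `![0, 2]`
  -- selects `(v, s)`.
  vsum (n := 2) fun w => a (reindex ![1, 0] w) * b (reindex ![0, 2] w)

theorem comp_cls₂ (a b : NetClass Ξ 2 → ℝ≥0∞) (G : Network Ξ) (o s : G.V) :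
    comp a b (G.cls₂ o s) = ∑' v, a (G.cls₂ o v) * b (G.cls₂ v s) := by
  have h1 : ∀ v, reindex ![1, 0] (mk ⟨G, ![v, o, s]⟩) = G.cls₂ o v := fun v =>
    congrArg (fun r => mk ⟨G, r⟩) (funext fun i => by fin_cases i <;> rfl)
  have h2 : ∀ v, reindex ![0, 2] (mk ⟨G, ![v, o, s]⟩) = G.cls₂ v s := fun v =>
    congrArg (fun r => mk ⟨G, r⟩) (funext fun i => by fin_cases i <;> rfl)
  exact tsum_congr fun v => congrArg₂ (fun p q => a p * b q) (h1 v) (h2 v)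

variable [MetricSpace Ξ]

theorem measurable_comp {a b : NetClass Ξ 2 → ℝ≥0∞} (ha : Measurable a) (hb : Measurable b) :
    Measurable (comp a b) :=
  measurable_vsum ((ha.comp (measurable_reindex _)).mul (hb.comp (measurable_reindex _)))

/-- The mass transport principle on the subset, for extended nonnegative functions. -/
theorem _root_.IsProperExtension.lintegral_out_eq {Ξ₀ : Type*} [MetricSpace Ξ₀] {ι : Ξ₀ → Ξ}
    {μ₀ : Measure (NetClass Ξ₀ 1)} {μ : Measure (NetClass Ξ 1)} {S : CovariantSubset Ξ}
    (hext : IsProperExtension ι μ₀ μ S) {g : NetClass Ξ 2 → ℝ≥0∞} (hg : Measurable g) :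
    ∫⁻ x, out (fun y => (rootIn S).indicator 1 (snd y) * g y) x ∂μ =
      ∫⁻ x, inn (fun y => (rootIn S).indicator 1 (fst y) * g y) x ∂μ := by
  have hm : Measurable ((rootIn S).indicator (1 : NetClass Ξ 1 → ℝ≥0∞)) :=
    measurable_one.indicator (measurableSet_rootIn S)
  refine lintegral_out_eq_inn_of_nnreal (hm.comp measurable_snd) (hm.comp measurable_fst)
    (fun f hf => ?_) hg
  refine Eq.trans (lintegral_congr fun x => ?_) ((hext.mtp f hf).trans
    (lintegral_congr fun x => ?_))
  · conv_lhs => rw [← x.cls₁_G_o]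
    rw [out_cls₁, tsum_subtype (S.carrier x.G) fun v => (f (x.G.cls₂ x.o v) : ℝ≥0∞)]
    refine tsum_congr fun v => ?_
    by_cases hv : v ∈ S.carrier x.G
    · simp [hv, cls₁_mem_rootIn.2 hv]
    · simp [hv, mt cls₁_mem_rootIn.1 hv]
  · conv_rhs => rw [← x.cls₁_G_o]
    rw [inn_cls₁, tsum_subtype (S.carrier x.G) fun v => (f (x.G.cls₂ v x.o) : ℝ≥0∞)]
    refine tsum_congr fun v => ?_
    by_cases hv : v ∈ S.carrier x.G
    · simp [hv, cls₁_mem_rootIn.2 hv]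
    · simp [hv, mt cls₁_mem_rootIn.1 hv]

/-- `T` sends total mass one out of each `z`, all of it into `S`; forwarding the mass of `a` along
`T` thus preserves its total, and the indicator loses nothing. -/
theorem tsum_rootIn_mul_comp_comp {S : CovariantSubset Ξ} {T : NetClass Ξ 2 → ℝ≥0}
    {G : Network Ξ} (hT : ∀ v : G.V, outflow T G v = 1 ∧
      ∀ z : G.V, z ∉ S.carrier G → T (G.cls₂ v z) = 0) (a : NetClass Ξ 2 → ℝ≥0∞) (o : G.V) :
    ∑' s, (rootIn S).indicator 1 (G.cls₁ s) * comp a (fun y => (T y : ℝ≥0∞)) (G.cls₂ o s) =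
      ∑' z, a (G.cls₂ o z) := by
  have h1 : ∀ s, (rootIn S).indicator 1 (G.cls₁ s) *
      comp a (fun y => (T y : ℝ≥0∞)) (G.cls₂ o s) = ∑' z, a (G.cls₂ o z) * T (G.cls₂ z s) := by
    intro s
    rw [comp_cls₂]
    by_cases hs : s ∈ S.carrier G
    · rw [Set.indicator_of_mem (cls₁_mem_rootIn.2 hs), Pi.one_apply, one_mul]
    · simp [(hT _).2 s hs]
  simp only [h1]
  rw [ENNReal.tsum_comm]
  refine tsum_congr fun z => ?_
  rw [ENNReal.tsum_mul_left]
  exact (congrArg _ (hT z).1).trans (mul_one _)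

/-- The measure `P'_T` is unimodular. -/
theorem isUnimodular_of_isPT' {Ξ₀ : Type*} [MetricSpace Ξ₀] {ι : Ξ₀ → Ξ}
    {μ₀ : Measure (NetClass Ξ₀ 1)} {μ P : Measure (NetClass Ξ 1)} {S : CovariantSubset Ξ}
    (hext : IsProperExtension ι μ₀ μ S) {T : NetClass Ξ 2 → ℝ≥0} (hT : IsMarkovianKernel μ S T)
    (hP : ∀ {f : NetClass Ξ 1 → ℝ≥0∞}, Measurable f →
      ∫⁻ x, f x ∂P = ∫⁻ x, (condMass μ T x)⁻¹ * inn (fun y => T y * f (fst y)) x ∂μ) :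
    IsUnimodular P := by
  intro g hg
  let t : NetClass Ξ 2 → ℝ≥0∞ := fun y => T y
  let γ : NetClass Ξ 2 → ℝ≥0∞ := fun y => g y
  let e : NetClass Ξ 1 → ℝ≥0∞ := fun x => (condMass μ T x)⁻¹
  have htm : Measurable t := hT.measurable.coe_nnreal_ennreal
  have hγm : Measurable γ := hg.coe_nnreal_ennreal
  have heI : Measurable[invariant Ξ] e := by
    have h : Measurable[invariant Ξ] (condMass μ T) := measurable_condLExp _ _ _
    exact h.inv
  have hem : Measurable e := heI.mono invariant_le le_rfl
  have hswap : Measurable (t ∘ swap) := htm.comp (measurable_reindex _)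
  -- `F(o, s)` is `e(o) ∑ T(v, o) g(v, z) T(z, s)` over all `v`, `z`: the mass `g(v, z)` with both
  -- ends carried to `S`. Summing over the second root in `S` gives the outflow integrand for `P`,
  -- over the first the inflow integrand, as `e` is invariant.
  let F : NetClass Ξ 2 → ℝ≥0∞ := fun y => e (fst y) * comp (comp (t ∘ swap) γ) t y
  have hF : Measurable F := (hem.comp measurable_fst).mul
    (measurable_comp (measurable_comp hswap hγm) htm)
  simp only [outflow_G_o, inflow_G_o]
  rw [hP (measurable_out hγm), hP (measurable_inn hγm)]
  refine Eq.trans (lintegral_congr_ae ?_) ((hext.lintegral_out_eq hF).trans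
    (lintegral_congr_ae ?_))
  · filter_upwards [hT.markov] with x hx
    rw [← x.cls₁_G_o]
    generalize x.o = o at *
    generalize x.G = G at *
    rw [out_cls₁]
    simp only [snd_cls₂, F, fst_cls₂, mul_left_comm _ (e (G.cls₁ o))]
    rw [ENNReal.tsum_mul_left, tsum_rootIn_mul_comp_comp hx]
    simp only [comp_cls₂]
    rw [ENNReal.tsum_comm, inn_cls₁]
    congr 1
    refine tsum_congr fun v => ?_
    rw [ENNReal.tsum_mul_left, fst_cls₂, out_cls₁]
    simp [t, γ]
  · filter_upwards [hT.markov] with x hx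
    rw [← x.cls₁_G_o]
    generalize x.o = o at *
    generalize x.G = G at *
    rw [inn_cls₁]
    have h1 : ∀ s, F (G.cls₂ s o) =
        e (G.cls₁ o) * ∑' z, t (G.cls₂ z o) * ∑' v, γ (G.cls₂ v z) * t (G.cls₂ v s) := by
      intro s
      simp only [F, fst_cls₂, comp_cls₂]
      rw [eq_of_measurable_invariant heI G s o]
      congr 1
      refine tsum_congr fun z => ?_
      rw [mul_comm]
      congr 1
      refine tsum_congr fun v => ?_
      rw [mul_comm, Function.comp, swap_cls₂]
    have h2 : ∀ s, (rootIn S).indicator 1 (G.cls₁ s) * F (G.cls₂ s o) = F (G.cls₂ s o) := by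
      intro s
      by_cases hs : s ∈ S.carrier G
      · rw [Set.indicator_of_mem (cls₁_mem_rootIn.2 hs), Pi.one_apply, one_mul]
      · rw [h1]
        simp [t, (hx _).2 s hs]
    simp only [fst_cls₂, h2]
    simp only [h1]
    rw [ENNReal.tsum_mul_left, ENNReal.tsum_comm, inn_cls₁]
    congr 1
    refine tsum_congr fun z => ?_
    rw [ENNReal.tsum_mul_left, fst_cls₂, inn_cls₁, ENNReal.tsum_comm]
    congr 1
    refine tsum_congr fun v => ?_
    rw [ENNReal.tsum_mul_left]
    exact (congrArg _ (hx v).1).trans (mul_one _)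

/-- The density of a unimodular measure with respect to another one does not depend on the root. -/
theorem ae_mem_allRoots_density {P ν : Measure (NetClass Ξ 1)} [IsFiniteMeasure ν]
    (hP : IsUnimodular P) (hν : IsUnimodular ν) {h : NetClass Ξ 1 → ℝ≥0∞} (hh : Measurable h)
    (hPν : ν = P.withDensity h) :
    ∃ A : Set (NetClass Ξ 1), MeasurableSet A ∧ (∀ᵐ x ∂P, x ∈ allRoots A) ∧
      ∀ (G : Network Ξ) (o : G.V), G.cls₁ o ∈ allRoots A → ∀ v, h (G.cls₁ v) = h (G.cls₁ o) := by
  obtain ⟨k, hk, hk0, hkin, hkout⟩ := exists_pos_inn_le_one_out_le_one Ξ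
  -- The test transport `κ` sends `k` from vertices of higher density to vertices of lower density.
  let L : Set (NetClass Ξ 2) := {y | h (snd y) < h (fst y)}
  have hL : MeasurableSet L := measurableSet_lt (hh.comp measurable_snd) (hh.comp measurable_fst)
  let κ : NetClass Ξ 2 → ℝ≥0∞ := L.indicator k
  have hκ : Measurable κ := hk.indicator hL
  have hκk : κ ≤ k := Set.indicator_le_self' fun _ _ => zero_le
  have hfκ : Measurable fun y => h (fst y) * κ y := (hh.comp measurable_fst).mul hκ
  have hsκ : Measurable fun y => h (snd y) * κ y := (hh.comp measurable_snd).mul hκ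
  have hle : (fun y => h (snd y) * κ y) ≤ fun y => h (fst y) * κ y := by
    intro y
    by_cases hy : y ∈ L
    · exact mul_le_mul_left (le_of_lt hy) _
    · simp [κ, hy]
  -- Mass transport for `ν` with `κ` and for `P` with `h(fst) κ` share the term `∫ h · out κ dP`.
  -- Yet the two inflows compared are ordered pointwise, strictly where `κ` is felt; being
  -- integrable, they force `κ` to vanish.
  have h1 : ∫⁻ x, inn (fun y => h (fst y) * κ y) x ∂P = ∫⁻ x, inn (fun y => h (snd y) * κ y) x ∂P := by
    have h2 := hν.lintegral_out_eq hκ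
    rw [hPν, lintegral_withDensity_eq_lintegral_mul _ hh (measurable_out hκ),
      lintegral_withDensity_eq_lintegral_mul _ hh (measurable_inn hκ)] at h2
    rw [← hP.lintegral_out_eq hfκ, lintegral_congr fun x => out_fst_mul h κ x,
      lintegral_congr fun x => inn_snd_mul h κ x]
    exact h2
  have hfin : ∫⁻ x, inn (fun y => h (snd y) * κ y) x ∂P ≠ ∞ := by
    refine ne_top_of_le_ne_top (measure_ne_top ν Set.univ) ?_
    rw [hPν, withDensity_apply _ MeasurableSet.univ, Measure.restrict_univ]
    refine lintegral_mono fun x => ?_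
    rw [inn_snd_mul]
    exact mul_le_of_le_one_right' ((inn_mono hκk x).trans (hkin x))
  have heq := ae_eq_of_ae_le_of_lintegral_le (μ := P)
    (Filter.Eventually.of_forall (inn_mono hle)) hfin (measurable_inn hfκ).aemeasurable h1.le
  have hlt : ∀ᵐ x ∂P, inn (fun y => h (snd y) * κ y) x < ∞ :=
    ae_lt_top (measurable_inn hsκ) hfin
  let A : Set (NetClass Ξ 1) := {x | inn κ x = 0}
  have hA : MeasurableSet A := measurable_inn hκ (measurableSet_singleton 0)
  refine ⟨A, hA, hP.ae_mem_allRoots hA ?_, ?_⟩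
  · filter_upwards [heq, hlt] with x hx hx'
    obtain ⟨G, o, rfl⟩ := exists_cls₁ x
    change inn κ (G.cls₁ o) = 0
    rw [inn_cls₁] at hx hx' ⊢
    rw [inn_cls₁] at hx
    refine ENNReal.tsum_eq_zero.2 fun v => ?_
    by_contra hne
    have hv : G.cls₂ v o ∈ L := Set.mem_of_indicator_ne_zero hne
    have hlt' : h (G.cls₁ o) < h (G.cls₁ v) := by
      have : h (snd (G.cls₂ v o)) < h (fst (G.cls₂ v o)) := hv
      rwa [fst_cls₂, snd_cls₂] at this
    have hktop : κ (G.cls₂ v o) ≠ ∞ := by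
      refine ne_top_of_le_ne_top ENNReal.one_ne_top (le_trans ?_ (hkin (G.cls₁ o)))
      refine (hκk _).trans ?_
      rw [inn_cls₁]
      exact ENNReal.le_tsum (f := fun v => k (G.cls₂ v o)) v
    refine (ENNReal.tsum_lt_tsum (i := v) hx'.ne (fun v => hle (G.cls₂ v o)) ?_).ne hx
    simp only [fst_cls₂, snd_cls₂]
    exact ENNReal.mul_lt_mul_left hne hktop hlt'
  · intro G o ho
    rw [cls₁_mem_allRoots] at ho
    have key : ∀ u v, h (G.cls₁ u) ≤ h (G.cls₁ v) := by
      intro u v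
      by_contra! hlt'
      have h2 : inn κ (G.cls₁ v) = 0 := ho v
      rw [inn_cls₁] at h2
      have h3 := ENNReal.tsum_eq_zero.1 h2 u
      have h4 : G.cls₂ u v ∈ L := by
        change h (snd (G.cls₂ u v)) < h (fst (G.cls₂ u v))
        rwa [fst_cls₂, snd_cls₂]
      exact hk0 (G.cls₂ u v) ((Set.indicator_of_mem h4 k).symm.trans h3)
    exact fun v => le_antisymm (key v o) (key o v)

/-- A unimodular measure that is absolutely continuous on invariant sets with respect to another
one is an invariant biasing of it. -/
theorem exists_isBiasing {P ν : Measure (NetClass Ξ 1)} [IsProbabilityMeasure P]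
    [IsProbabilityMeasure ν] (hP : IsUnimodular P) (hν : IsUnimodular ν)
    (hac : ∀ D, MeasurableSet[invariant Ξ] D → P D = 0 → ν D = 0) :
    ∃ w : NetClass Ξ 1 → ℝ≥0,
      (∀ (G : Network Ξ) (o v : G.V), w (G.cls₁ o) = w (G.cls₁ v)) ∧ IsBiasing P w ν := by
  have hνP : ν ≪ P := by
    refine Measure.AbsolutelyContinuous.mk fun A hA h => ?_
    -- A `P`-null `A` is almost surely seen from no vertex. That some vertex sees `A` is thus an
    -- invariant `P`-null event, to which `hac` applies.
    have hD : MeasurableSet[invariant Ξ] (allRoots Aᶜ)ᶜ := (measurableSet_allRoots hA.compl).compl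
    have h1 := hP.ae_mem_allRoots hA.compl (measure_eq_zero_iff_ae_notMem.1 h)
    refine measure_mono_null ?_ (hac _ hD h1)
    exact fun x hx hx' => allRoots_subset _ hx' hx
  let h := ν.rnDeriv P
  have hh : Measurable h := Measure.measurable_rnDeriv _ _
  have hPν : ν = P.withDensity h := (Measure.withDensity_rnDeriv_eq _ _ hνP).symm
  obtain ⟨A, hA, hAae, hAh⟩ := ae_mem_allRoots_density hP hν hh hPν
  -- Setting `w` to zero off the invariant set `allRoots A` makes it independent of the root for
  -- every network, not just almost surely.
  let w : NetClass Ξ 1 → ℝ≥0 := (allRoots A).indicator fun x => (h x).toNNReal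
  have hw : Measurable w := hh.ennreal_toNNReal.indicator (measurableSet_allRoots hA).1
  have hwh : (fun x => (w x : ℝ≥0∞)) =ᵐ[P] h := by
    filter_upwards [hAae, Measure.rnDeriv_lt_top ν P] with x hx hx'
    have : w x = (h x).toNNReal := Set.indicator_of_mem hx _
    rw [this, ENNReal.coe_toNNReal hx'.ne]
  have hwν : P.withDensity (fun x => (w x : ℝ≥0∞)) = ν := (withDensity_congr_ae hwh).trans hPν.symm
  have hone : ∫⁻ x, (w x : ℝ≥0∞) ∂P = 1 := by
    rw [← setLIntegral_univ, ← withDensity_apply _ MeasurableSet.univ, hwν, measure_univ]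
  refine ⟨w, fun G o v => ?_, hw, ?_, ?_, ?_⟩
  · by_cases ho : G.cls₁ o ∈ allRoots A
    · have hv : G.cls₁ v ∈ allRoots A := cls₁_mem_allRoots.2 (cls₁_mem_allRoots.1 ho)
      simp only [w, Set.indicator_of_mem ho, Set.indicator_of_mem hv, hAh G o ho v]
    · have hv : G.cls₁ v ∉ allRoots A := fun hv =>
        ho (cls₁_mem_allRoots.2 (cls₁_mem_allRoots.1 hv))
      simp only [w, Set.indicator_of_notMem ho, Set.indicator_of_notMem hv]
  · rw [hone]; exact one_pos
  · rw [hone]; exact ENNReal.one_lt_top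
  · rw [hone, inv_one, one_smul, hwν]

/-- The measure `P'_T` charges all invariant sets that are charged by the original measure. -/
theorem measure_eq_zero_of_isPT' {μ P : Measure (NetClass Ξ 1)} [IsFiniteMeasure μ]
    {T : NetClass Ξ 2 → ℝ≥0} (hT : Measurable T) (hPT : IsPT' μ T P) {D : Set (NetClass Ξ 1)}
    (hD : MeasurableSet[invariant Ξ] D) (hPD : P D = 0) : μ D = 0 := by
  have hTm : Measurable (inn fun y => (T y : ℝ≥0∞)) := measurable_inn hT.coe_nnreal_ennreal
  have hcm : Measurable (condMass μ T) := measurable_condLExp' _ _ _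
  -- The indicator of an invariant set is the same at `v` as at the root, so `P D` is the integral
  -- of `M / E[M | I]` over `D`.
  have h1 : ∀ x, ∑' v : x.G.V, (T (x.G.cls₂ v x.o) : ℝ≥0∞) * D.indicator 1 (x.G.cls₁ v) =
      D.indicator 1 x * inn (fun y => (T y : ℝ≥0∞)) x := by
    intro x
    rw [tsum_mul_indicator_eq_inn, ← inn_snd_mul]
    congr 1
    funext y
    obtain ⟨G, u, v, rfl⟩ := exists_cls₂ y
    rw [fst_cls₂, snd_cls₂, mul_comm]
    by_cases hv : G.cls₁ v ∈ D
    · simp [hv, hD.2 G v u hv]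
    · simp [hv, mt (hD.2 G u v) hv]
  rw [hPT.apply_eq D hD.1] at hPD
  simp only [h1] at hPD
  replace hPD := (lintegral_eq_zero_iff (hcm.inv.mul
    ((measurable_one.indicator hD.1).mul hTm))).1 hPD
  -- Since `E[M | I]` is finite, its inverse is nonzero, so `P D = 0` makes `M` vanish on `D`. Then
  -- `E[M | I]` vanishes there too, against its positivity unless `D` is null.
  have h2 : ∫⁻ x in D, condMass μ T x ∂μ = 0 := by
    rw [condMass, setLIntegral_condLExp invariant_le μ _ hD]
    refine (setLIntegral_eq_zero_iff hD.1 ?_).2 ?_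
    · simp only [inflow_G_o]; exact hTm
    · filter_upwards [hPD, hPT.lt_top] with x hx hx' hxD
      rw [inflow_G_o]
      simpa [hxD, hx'.ne] using hx
  have h3 := (setLIntegral_eq_zero_iff hD.1 hcm).1 h2
  refine measure_eq_zero_iff_ae_notMem.2 ?_
  filter_upwards [h3, hPT.pos] with x hx hx' hxD
  exact hx'.ne' (hx hxD)

end NetClass

theorem mainTheorem7 {Ξ₀ Ξ : Type*}
    [MetricSpace Ξ₀] [CompleteSpace Ξ₀] [TopologicalSpace.SeparableSpace Ξ₀]
    [MetricSpace Ξ] [CompleteSpace Ξ] [TopologicalSpace.SeparableSpace Ξ]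
    (ι : Ξ₀ → Ξ) (hι : Isometry ι)
    (μ₀ : Measure (NetClass Ξ₀ 1)) [IsProbabilityMeasure μ₀]
    (μ : Measure (NetClass Ξ 1)) [IsProbabilityMeasure μ]
    (S : CovariantSubset Ξ) (hext : IsProperExtension ι μ₀ μ S)
    (huni : ∃ ν, IsUnimodularization ν μ) :
    (∃ T : NetClass Ξ 2 → ℝ≥0, IsMarkovianKernel μ S T ∧
      (∃ P, IsPT' μ T P) ∧
      ∃ c : NetClass Ξ 0 → ℝ≥0, Measurable c ∧
        ∀ᵐ (x : NetClass Ξ 1) ∂μ, ∀ v : x.G.V, v ∈ S.carrier x.G → inflow T x.G v = c x.G.cls₀) ∧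
    (∀ (T : NetClass Ξ 2 → ℝ≥0) (P : Measure (NetClass Ξ 1)),
      IsMarkovianKernel μ S T → IsPT' μ T P →
        ∀ ν, IsUnimodularization ν μ →
          ∃ w : NetClass Ξ 1 → ℝ≥0,
            (∀ (G : Network Ξ) (o v : G.V), w (G.cls₁ o) = w (G.cls₁ v)) ∧
            IsBiasing P w ν) := by
  obtain ⟨ν, hν⟩ := huni
  refine ⟨NetClass.exists_markovianKernel hext.root_mem hν, fun T P hT hPT ν hν => ?_⟩
  have := hPT.isProbabilityMeasure
  have := hν.isProbabilityMeasure
  have hcm : Measurable fun x => (condMass μ T x)⁻¹ := (measurable_condLExp' _ _ _).inv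
  have hP : IsUnimodular P := NetClass.isUnimodular_of_isPT' hext hT fun hf =>
    NetClass.lintegral_transport_measure hT.measurable hcm
      (fun A hA => by simp only [hPT.apply_eq A hA, NetClass.tsum_mul_indicator_eq_inn]) hf
  exact NetClass.exists_isBiasing hP hν.isUnimodular fun D hD h =>
    NetClass.measure_eq_zero_of_map_π hν.absolutelyContinuous hD
      (NetClass.measure_eq_zero_of_isPT' hT.measurable hPT hD h)
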